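/- Let $M$ be a connected, oriented, smooth real 4-manifold equipped with a smooth Lorentzian metric $g$ and a smooth affine connection $\Gamma$, with $\nabla_\mu v^\lambda=\partial_\mu v^\lambda+\Gamma^\lambda{}_{\mu\nu}v^\nu$, curvature $R^\kappa{}_{\lambda\mu\nu}=\partial_\mu\Gamma^\kappa{}_{\nu\lambda}-\partial_\nu\Gamma^\kappa{}_{\mu\lambda}+\Gamma^\kappa{}_{\mu\eta}\Gamma^\eta{}_{\nu\lambda}-\Gamma^\kappa{}_{\nu\eta}\Gamma^\eta{}_{\mu\lambda}$ and torsion $T^\lambda{}_{\mu\nu}=\Gamma^\lambda{}_{\mu\nu}-\Gamma^\lambda{}_{\nu\mu}$. Suppose that $(M,g,\Gamma)$ is a generalised pp-wave with purely axial torsion, that is: (a) $\nabla g=0$; (b) there is a vector field $l$ on $M$ such that around every point there are local coordinates in which $$ds^2=2\,dx^0dx^3-(dx^1)^2-(dx^2)^2+f(x^1,x^2,x^3)\,(dx^3)^2,\qquad l^\mu=(1,0,0,0),$$ for some real function $f$ (depending on the coordinate system); (c) there are a function $\varphi:M\to\mathbb R$ (the phase) with $\partial_\mu\varphi=l_\mu$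 and a function $k:\mathbb R\to\mathbb R$ such that $T=*A$ with $A=k(\varphi)\,l$, i.e. $T_{\kappa\mu\nu}=\sqrt{|\det g|}\,A^\lambda\varepsilon_{\lambda\kappa\mu\nu}$ in positively oriented coordinates. Then: (i) In any local coordinates in which $g$ has the form displayed in (b), the Ricci curvature $\{Ric\}$ of the Levi-Civita connection is parallel with respect to the Levi-Civita connection if and only if $f_{11}+f_{22}$ is locally constant, where $f_{\alpha\beta}=\partial_\alpha\partial_\beta f$. (ii) If $\{Ric\}$ is parallel with respect to the Levi-Civita connection on $M$, then $(g,\Gamma)$ solves both Euler–Lagrange equations $\partial S/\partial g=0$ and $\partial S/\partial\Gamma=0$ of the Yang–Mills action $$S=\int R^\kappa{}_{\lambda\mu\nu}\,R^\lambda{}_\kappa{}^{\mu\nu}\,\sqrt{|\det g|}\,dx^0dx^1dx^2dx^3,$$ where $g$ and $\Gamma$ are varied independently. That is, in every local coordinate system and for every compact set $K$ in its range, the integral over $K$ has zero first derivative along every smooth variation $g+t\,h$ ($h$ symmetric, supported in $K$, $\Gamma$ fixed) and along every smooth variation $\Gamma+t\,\delta$ (all 64 components of $\delta$ arbitrary,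 supported in $K$, $g$ fixed). -/

import Mathlib

open scoped Manifold ContDiff

noncomputable section

namespace MAG

/-! ### Local coordinate calculus on `ℝ⁴`

A tensor field in local coordinates is given by its components, which are functions on `ℝ⁴`;
only their values on the range of the coordinate chart in question matter. -/

/-- The coordinate space `ℝ⁴`, with coordinates `x 0, x 1, x 2, x 3`. -/
abbrev R4 : Type := Fin 4 → ℝ

/-- The partial derivative `∂_μ F`. -/
def pd (μ : Fin 4) (F : R4 → ℝ) (x : R4) : ℝ :=
  fderiv ℝ F x (Pi.single μ 1)

/-- Components `g_{μν}` of a covariant 2-tensor field. -/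
abbrev TwoTensor : Type := R4 → Matrix (Fin 4) (Fin 4) ℝ

/-- Components `Γ^λ_{μν}`, in the order `Γ x λ μ ν`. The convention for the covariant derivative is
`∇_μ v^λ = ∂_μ v^λ + Γ^λ_{μν} v^ν`. -/
abbrev Coeffs : Type := R4 → Fin 4 → Fin 4 → Fin 4 → ℝ

/-- The curvature
`R^κ_{λμν} = ∂_μ Γ^κ_{νλ} - ∂_ν Γ^κ_{μλ} + Γ^κ_{μη} Γ^η_{νλ} - Γ^κ_{νη} Γ^η_{μλ}`. -/
def curvature (Γ : Coeffs) (x : R4) (κ lam μ ν : Fin 4) : ℝ :=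
  pd μ (fun y => Γ y κ ν lam) x - pd ν (fun y => Γ y κ μ lam) x
    + ∑ η, (Γ x κ μ η * Γ x η ν lam - Γ x κ ν η * Γ x η μ lam)

/-- The Ricci curvature `Ric_{λν} = R^κ_{λκν}`. -/
def ricci (Γ : Coeffs) (x : R4) (lam ν : Fin 4) : ℝ :=
  ∑ κ, curvature Γ x κ lam κ ν

/-- The covariant derivative `∇_ρ Q_{μν}` of a covariant 2-tensor field. -/
def covDeriv₂ (Γ : Coeffs) (Q : R4 → Fin 4 → Fin 4 → ℝ) (x : R4) (ρ μ ν : Fin 4) : ℝ :=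
  pd ρ (fun y => Q y μ ν) x - ∑ η, (Γ x η ρ μ * Q x η ν + Γ x η ρ ν * Q x μ η)

/-- The Levi-Civita connection (Christoffel symbols) of `g`. -/
def leviCivita (g : TwoTensor) : Coeffs := fun x lam μ ν =>
  (1 / 2) * ∑ κ, (g x)⁻¹ lam κ *
    (pd μ (fun y => g y κ ν) x + pd ν (fun y => g y κ μ) x - pd κ (fun y => g y μ ν) x)

/-- The torsion `T^λ_{μν} = Γ^λ_{μν} - Γ^λ_{νμ}`. -/
def torsion (Γ : Coeffs) (x : R4) (lam μ ν : Fin 4) : ℝ :=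
  Γ x lam μ ν - Γ x lam ν μ

/-- The torsion with its first index lowered, `T_{κμν} = g_{κλ} T^λ_{μν}`. -/
def torsionLow (g : TwoTensor) (Γ : Coeffs) (x : R4) (κ μ ν : Fin 4) : ℝ :=
  ∑ lam, g x κ lam * torsion Γ x lam μ ν

/-- The Levi-Civita symbol, totally antisymmetric with `ε_{0123} = 1`. -/
def eps (κ lam μ ν : Fin 4) : ℝ :=
  Matrix.det (Matrix.of fun a b : Fin 4 => if (![κ, lam, μ, ν] : Fin 4 → Fin 4) a = b then (1 : ℝ) else 0)

/-- The Hodge dual of a vector at `x`: `(∗A)_{κμν} = √|det g| A^λ ε_{λκμν}`, where `s = ±1` is the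
sign of the coordinate system relative to the orientation. -/
def hodgeVector (g : TwoTensor) (s : ℝ) (A : Fin 4 → ℝ) (x : R4) (κ μ ν : Fin 4) : ℝ :=
  s * Real.sqrt |(g x).det| * ∑ lam, A lam * eps lam κ μ ν

/-- The Yang-Mills quadratic form `q(R) = R^κ_{λμν} R^λ_κ^{μν}`. -/
def yangMills (g : TwoTensor) (Γ : Coeffs) (x : R4) : ℝ :=
  ∑ κ, ∑ lam, ∑ μ, ∑ ν, ∑ α, ∑ β,
    curvature Γ x κ lam μ ν * curvature Γ x lam κ α β * ((g x)⁻¹ μ α * (g x)⁻¹ ν β)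

/-- The action `∫_K q(R) √|det g| dx⁰dx¹dx²dx³` over a region `K`. -/
def action (K : Set R4) (g : TwoTensor) (Γ : Coeffs) : ℝ :=
  ∫ x in K, yangMills g Γ x * Real.sqrt |(g x).det|

/-- The Euler-Lagrange equation `∂S/∂g = 0` on `U`, with `Γ` fixed: the action over any compact
region is stationary under all smooth symmetric variations of `g` supported in that region. -/
def MetricStationary (U : Set R4) (g : TwoTensor) (Γ : Coeffs) : Prop :=
  ∀ (K : Set R4) (h : TwoTensor), IsCompact K → K ⊆ U →
    (∀ μ ν, ContDiff ℝ ∞ fun x => h x μ ν) →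
    (∀ μ ν, tsupport (fun x => h x μ ν) ⊆ K) →
    (∀ x, (h x).IsSymm) →
    HasDerivAt (fun t : ℝ => action K (fun x => g x + t • h x) Γ) 0 0

/-- The Euler-Lagrange equation `∂S/∂Γ = 0` on `U`, with `g` fixed: the action over any compact
region is stationary under all smooth variations of the 64 connection coefficients supported in
that region. -/
def ConnectionStationary (U : Set R4) (g : TwoTensor) (Γ : Coeffs) : Prop :=
  ∀ (K : Set R4) (δ : Coeffs), IsCompact K → K ⊆ U →
    (∀ lam μ ν, ContDiff ℝ ∞ fun x => δ x lam μ ν) →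
    (∀ lam μ ν, tsupport (fun x => δ x lam μ ν) ⊆ K) →
    HasDerivAt (fun t : ℝ => action K g (fun x => Γ x + t • δ x)) 0 0

/-- The pp-metric `2 dx⁰dx³ - (dx¹)² - (dx²)² + f(x¹,x²,x³) (dx³)²`. -/
def ppMetric (f : ℝ → ℝ → ℝ → ℝ) : TwoTensor := fun x =>
  !![0, 0, 0, 1;
     0, -1, 0, 0;
     0, 0, -1, 0;
     1, 0, 0, f (x 1) (x 2) (x 3)]

/-- `f_{11} + f_{22}`, for `f` regarded as a function of the coordinates. -/
def transverseLaplacian (f : ℝ → ℝ → ℝ → ℝ) (x : R4) : ℝ :=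
  pd 1 (pd 1 fun y => f (y 1) (y 2) (y 3)) x + pd 2 (pd 2 fun y => f (y 1) (y 2) (y 3)) x

/-! ### Spacetimes

A field on a 4-manifold is given by its components in every coordinate chart of the maximal smooth
atlas, subject to the transformation law under changes of coordinates. -/

section Manifold

variable (M : Type*) [TopologicalSpace M] [ChartedSpace R4 M]

/-- Local coordinate systems: the charts of the maximal smooth atlas. -/
def Chart : Type _ :=
  {e : OpenPartialHomeomorph M R4 // e ∈ IsManifold.maximalAtlas 𝓘(ℝ, R4) ∞ M}

variable {M}

/-- The open subset of `ℝ⁴` on which the coordinate components live. -/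
def Chart.range (e : Chart M) : Set R4 := e.1.target

/-- The point of `M` with given coordinates. -/
def Chart.point (e : Chart M) (x : R4) : M := e.1.symm x

/-- The set of coordinates `x` (with respect to `e`) of the points lying also in the domain of the
coordinate system `e'`. -/
def Chart.overlap (e e' : Chart M) : Set R4 := {x | x ∈ e.range ∧ e.point x ∈ e'.1.source}

/-- The change of coordinates `x ↦ x'` from `e` to `e'`. -/
def Chart.change (e e' : Chart M) (x : R4) : R4 := e'.1 (e.point x)

/-- The Jacobian `∂x'^α/∂x^μ` of the change of coordinates from `e` to `e'`. -/
def Chart.jac (e e' : Chart M) (x : R4) : Matrix (Fin 4) (Fin 4) ℝ :=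
  Matrix.of fun α μ => pd μ (fun y => e.change e' y α) x

variable (M)

/-- A spacetime structure on a 4-manifold: a smooth Lorentzian metric (signature `+ - - -`) and a
smooth affine connection. -/
structure Spacetime where
  /-- components `g_{μν}` -/
  g : Chart M → TwoTensor
  /-- components `Γ^λ_{μν}` -/
  Γ : Chart M → Coeffs
  g_smooth : ∀ e μ ν, ContDiffOn ℝ ∞ (fun x => g e x μ ν) e.range
  g_symm : ∀ e, ∀ x ∈ e.range, (g e x).IsSymm
  g_lorentz : ∀ e, ∀ x ∈ e.range, ∃ P : Matrix (Fin 4) (Fin 4) ℝ,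
    IsUnit P.det ∧ P.transpose * g e x * P = Matrix.diagonal ![1, -1, -1, -1]
  g_change : ∀ e e', ∀ x ∈ e.overlap e', ∀ μ ν,
    g e x μ ν = ∑ α, ∑ β, e.jac e' x α μ * e.jac e' x β ν * g e' (e.change e' x) α β
  Γ_smooth : ∀ e lam μ ν, ContDiffOn ℝ ∞ (fun x => Γ e x lam μ ν) e.range
  Γ_change : ∀ e e', ∀ x ∈ e.overlap e', ∀ α μ ν,
    ∑ lam, e.jac e' x α lam * Γ e x lam μ ν =
      (∑ β, ∑ γ, Γ e' (e.change e' x) α β γ * e.jac e' x β μ * e.jac e' x γ ν)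
        + pd μ (fun y => e.jac e' y α ν) x

/-- An orientation of a 4-manifold: it assigns to every coordinate system, at every point, a sign
(`1` if the coordinates are positively oriented, `-1` otherwise). -/
structure Orientation where
  /-- the sign of the coordinate system `e` -/
  sgn : Chart M → R4 → ℝ
  sgn_eq : ∀ e, ∀ x ∈ e.range, sgn e x = 1 ∨ sgn e x = -1
  sgn_cont : ∀ e, ContinuousOn (sgn e) e.range
  sgn_change : ∀ e e', ∀ x ∈ e.overlap e',
    sgn e x = SignType.sign (e.jac e' x).det * sgn e' (e.change e' x)

/-- A smooth real vector field. -/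
structure VecField where
  /-- components `l^μ` -/
  v : Chart M → R4 → Fin 4 → ℝ
  v_smooth : ∀ e μ, ContDiffOn ℝ ∞ (fun x => v e x μ) e.range
  v_change : ∀ e e', ∀ x ∈ e.overlap e', ∀ α,
    v e' (e.change e' x) α = ∑ μ, e.jac e' x α μ * v e x μ

variable {M}

namespace Spacetime

/-- `∇ g = 0`. -/
def MetricCompatible (S : Spacetime M) : Prop :=
  ∀ e, ∀ x ∈ e.range, ∀ ρ μ ν, covDeriv₂ (S.Γ e) (S.g e) x ρ μ ν = 0

/-- In the coordinate system `e` the Ricci curvature of the Levi-Civita connection is parallel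
with respect to the Levi-Civita connection. -/
def LCRicciParallelIn (S : Spacetime M) (e : Chart M) : Prop :=
  ∀ x ∈ e.range, ∀ ρ μ ν,
    covDeriv₂ (leviCivita (S.g e)) (ricci (leviCivita (S.g e))) x ρ μ ν = 0

/-- The Ricci curvature of the Levi-Civita connection is parallel with respect to the Levi-Civita
connection. -/
def LCRicciParallel (S : Spacetime M) : Prop := ∀ e, S.LCRicciParallelIn e

/-- In the coordinate system `e` the metric is the pp-metric with profile `f`. -/
def IsPPMetricIn (S : Spacetime M) (e : Chart M) (f : ℝ → ℝ → ℝ → ℝ) : Prop :=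
  ∀ x ∈ e.range, S.g e x = ppMetric f x

/-- `S` carries a pp-metric and `l` is its distinguished null vector field: every point has
coordinates in which the metric is a pp-metric and `l^μ = (1, 0, 0, 0)`. -/
def IsPPWith (S : Spacetime M) (l : VecField M) : Prop :=
  ∀ p : M, ∃ e : Chart M, p ∈ e.1.source ∧
    (∃ f, S.IsPPMetricIn e f) ∧ ∀ x ∈ e.range, l.v e x = ![1, 0, 0, 0]

/-- `φ` is a phase for `l`, that is `φ = ∫ l · dx`: `∂_μ φ = l_μ`. -/
def IsPhase (S : Spacetime M) (l : VecField M) (φ : M → ℝ) : Prop :=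
  ∀ e : Chart M, ContDiffOn ℝ ∞ (fun x => φ (e.point x)) e.range ∧
    ∀ x ∈ e.range, ∀ μ, pd μ (fun y => φ (e.point y)) x = ∑ ν, S.g e x μ ν * l.v e x ν

/-- The torsion is `T = ∗A` with `A = k(φ) l`. -/
def TorsionIsDual (S : Spacetime M) (o : Orientation M) (l : VecField M) (φ : M → ℝ)
    (k : ℝ → ℝ) : Prop :=
  ∀ e, ∀ x ∈ e.range, ∀ κ μ ν, torsionLow (S.g e) (S.Γ e) x κ μ ν =
    hodgeVector (S.g e) (o.sgn e x) (fun lam => k (φ (e.point x)) * l.v e x lam) x κ μ ν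

/-- A generalised pp-wave with purely axial torsion: a metric compatible spacetime with pp-metric
and torsion `T = ∗A`, `A = k(φ) l`, where `φ` is the phase and `k` is some real function. -/
def IsGeneralisedPPWave (S : Spacetime M) (o : Orientation M) : Prop :=
  S.MetricCompatible ∧ ∃ (l : VecField M) (φ : M → ℝ) (k : ℝ → ℝ),
    S.IsPPWith l ∧ S.IsPhase l φ ∧ S.TorsionIsDual o l φ k

/-- The Euler-Lagrange equation `∂S/∂g = 0` of the Yang-Mills action, in all local coordinates. -/
def SolvesMetricEquation (S : Spacetime M) : Prop :=
  ∀ e, MetricStationary e.range (S.g e) (S.Γ e)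

/-- The Euler-Lagrange equation `∂S/∂Γ = 0` of the Yang-Mills action, in all local coordinates. -/
def SolvesConnectionEquation (S : Spacetime M) : Prop :=
  ∀ e, ConnectionStationary e.range (S.g e) (S.Γ e)

end Spacetime

end Manifold

end MAG

end

/-!
Let `R_{μν}` be the matrix `(R^κ_{λμν})` of the curvature two-form. The proof of the two
Euler-Lagrange equations rests on two pointwise identities, valid in every coordinate system:

* `tr (R_{μν} R_{αβ}) = 0` for all indices, and
* the Yang-Mills equation `∑_μ (∂_μ P^{μν} + [Γ_μ, P^{μν}]) = 0` for the density
  `P^{μν} = √|det g| R^{μν}`.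

The first one makes the Yang-Mills integrand vanish for every metric, so that the action is constant
under variations of `g` (`metricStationary_of_trace_eq_zero`). It also makes the action, along
`Γ + t δ`, a polynomial in `t` without constant term, whose linear coefficient is the integral of a
divergence minus a pairing of `δ` with the left-hand side of the Yang-Mills equation
(`first_variation_eq_divergence`, `connectionStationary_of_yangMills`).

Both identities are independent of the coordinates, so it is enough to check them in a chart with a
pp-metric. This is shown by splitting a change of coordinates into a change of frame
(`fieldStrength_gauge`, `gaugeDiv_gauge`) and a pullback (`fieldStrength_pullback`,
`gaugeDiv_pullback`); the pullback of the divergence needs Piola's identity (`piola`), which follows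
from Jacobi's formula for the derivative of a determinant.

In a pp-chart a metric compatible connection with axial torsion is the Levi-Civita connection plus
half the torsion, and the phase condition makes the torsion amplitude `a = ± k(φ)` a function of
`x³` only. The curvature is then confined to the components `R_{31}` and `R_{32}`, with values in the
abelian algebra of null rotations about `l`, on which the trace form vanishes
(`fieldStrength_ppForm`), and its divergence involves only the gradient of `f₁₁ + f₂₂`
(`gaugeDiv_ppForm`). The Levi-Civita connection is the case `a = 0`: its only Ricci component is
`Ric_{33} = (f₁₁ + f₂₂) / 2`, and the covariant derivative of `Ric` is the gradient of that function
(`covDeriv_ricci_leviCivita_pp`). Hence the Ricci curvature is parallel if and only if `f₁₁ + f₂₂`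
is locally constant, and in that case the Yang-Mills equation holds.
-/

noncomputable section

namespace MAG

open Filter Topology

/-! ### Calculus of partial derivatives -/

section PartialDerivatives

variable {F G : R4 → ℝ} {x : R4} {μ ν : Fin 4}

theorem smooth_differentiableAt (hF : ContDiffAt ℝ ∞ F x) : DifferentiableAt ℝ F x :=
  hF.differentiableAt (by simp)

theorem pd_congr (h : F =ᶠ[𝓝 x] G) : pd μ F x = pd μ G x := by
  unfold pd; rw [h.fderiv_eq]

theorem pd_const (c : ℝ) : pd μ (fun _ => c) x = 0 := by
  simp [pd]

theorem pd_add (hF : DifferentiableAt ℝ F x) (hG : DifferentiableAt ℝ G x) :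
    pd μ (fun y => F y + G y) x = pd μ F x + pd μ G x := by
  simp [pd, fderiv_fun_add hF hG]

theorem pd_sub (hF : DifferentiableAt ℝ F x) (hG : DifferentiableAt ℝ G x) :
    pd μ (fun y => F y - G y) x = pd μ F x - pd μ G x := by
  simp [pd, fderiv_fun_sub hF hG]

theorem pd_neg : pd μ (fun y => -F y) x = -pd μ F x := by
  simp [pd, fderiv_fun_neg]

theorem pd_mul (hF : DifferentiableAt ℝ F x) (hG : DifferentiableAt ℝ G x) :
    pd μ (fun y => F y * G y) x = pd μ F x * G x + F x * pd μ G x := by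
  simp [pd, fderiv_fun_mul hF hG]; ring

theorem pd_const_mul (c : ℝ) : pd μ (fun y => c * F y) x = c * pd μ F x := by
  have h : (fun y => c * F y) = c • F := rfl
  rw [h, pd, fderiv_const_smul_field]
  rfl

theorem pd_sum {ι : Type*} (s : Finset ι) {f : ι → R4 → ℝ}
    (hf : ∀ i ∈ s, DifferentiableAt ℝ (f i) x) :
    pd μ (fun y => ∑ i ∈ s, f i y) x = ∑ i ∈ s, pd μ (f i) x := by
  simp [pd, fderiv_fun_sum hf]

theorem pd_smooth (hF : ContDiffAt ℝ ∞ F x) : ContDiffAt ℝ ∞ (pd μ F) x := by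
  unfold pd
  exact (hF.fderiv_right (m := ∞) (by simp)).clm_apply contDiffAt_const

/-- Second partial derivatives commute. -/
theorem pd_comm (hF : ContDiffAt ℝ ∞ F x) : pd μ (pd ν F) x = pd ν (pd μ F) x := by
  have hd : DifferentiableAt ℝ (fderiv ℝ F) x :=
    (hF.fderiv_right (m := ∞) (by simp)).differentiableAt (by simp)
  have key : ∀ α β, pd α (pd β F) x = fderiv ℝ (fderiv ℝ F) x (Pi.single α 1) (Pi.single β 1) := by
    intro α β
    unfold pd
    rw [fderiv_clm_apply hd (differentiableAt_const _)]
    simp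
  rw [key, key]
  exact (hF.isSymmSndFDerivAt (by
    simp only [minSmoothness_of_isRCLikeNormedField]; exact ENat.LEInfty.out)).eq _ _

theorem fderiv_eq_sum_pd (v : R4) : fderiv ℝ F x v = ∑ α, v α * pd α F x := by
  conv_lhs => rw [show v = ∑ α, v α • (Pi.single α (1 : ℝ) : R4) by
    ext i; simp [Finset.sum_apply, Pi.single_apply]]
  simp [pd]

/-- The chain rule. -/
theorem pd_comp {Φ : R4 → R4} (hF : DifferentiableAt ℝ F (Φ x))
    (hΦ : ∀ α, DifferentiableAt ℝ (fun y => Φ y α) x) :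
    pd μ (fun y => F (Φ y)) x = ∑ α, pd μ (fun y => Φ y α) x * pd α F (Φ x) := by
  have hΦ' : DifferentiableAt ℝ Φ x := differentiableAt_pi.2 hΦ
  have h1 : fderiv ℝ (fun y => F (Φ y)) x = (fderiv ℝ F (Φ x)).comp (fderiv ℝ Φ x) :=
    fderiv_comp x hF hΦ'
  have h2 : ∀ α, pd μ (fun y => Φ y α) x = fderiv ℝ Φ x (Pi.single μ 1) α := by
    intro α
    unfold pd
    rw [fderiv_apply hΦ']
    rfl
  simp only [h2]
  rw [← fderiv_eq_sum_pd, pd, h1]; rfl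

end PartialDerivatives

/-! ### Matrix-valued functions -/

/-- A `4 × 4` matrix. -/
abbrev Mat : Type := Matrix (Fin 4) (Fin 4) ℝ

/-- Smoothness of a matrix-valued function near a point, entry by entry. -/
def MSmoothAt (A : R4 → Mat) (x : R4) : Prop :=
  ∀ i j, ContDiffAt ℝ ∞ (fun y => A y i j) x

/-- The partial derivative of a matrix-valued function, entry by entry. -/
def mpd (μ : Fin 4) (A : R4 → Mat) (x : R4) : Mat :=
  Matrix.of fun i j => pd μ (fun y => A y i j) x

section MatrixCalculus

variable {A B : R4 → Mat} {f : R4 → ℝ} {x : R4} {μ ν : Fin 4}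

theorem MSmoothAt.mul (hA : MSmoothAt A x) (hB : MSmoothAt B x) :
    MSmoothAt (fun y => A y * B y) x := by
  intro i j
  simp only [Matrix.mul_apply]
  exact ContDiffAt.sum fun k _ => (hA i k).mul (hB k j)

theorem MSmoothAt.add (hA : MSmoothAt A x) (hB : MSmoothAt B x) :
    MSmoothAt (fun y => A y + B y) x := fun i j => (hA i j).add (hB i j)

theorem MSmoothAt.sub (hA : MSmoothAt A x) (hB : MSmoothAt B x) :
    MSmoothAt (fun y => A y - B y) x := fun i j => (hA i j).sub (hB i j)

theorem MSmoothAt.smul (hf : ContDiffAt ℝ ∞ f x) (hA : MSmoothAt A x) :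
    MSmoothAt (fun y => f y • A y) x := fun i j => hf.mul (hA i j)

theorem MSmoothAt.sum {ι : Type*} {s : Finset ι} {A : ι → R4 → Mat}
    (hA : ∀ i ∈ s, MSmoothAt (A i) x) : MSmoothAt (fun y => ∑ i ∈ s, A i y) x := by
  intro i j
  simp only [Matrix.sum_apply]
  exact ContDiffAt.sum fun k hk => hA k hk i j

theorem MSmoothAt.mpd (hA : MSmoothAt A x) : MSmoothAt (mpd μ A) x :=
  fun i j => pd_smooth (hA i j)

theorem MSmoothAt.comp {Φ : R4 → R4} (hA : MSmoothAt A (Φ x))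
    (hΦ : ∀ α, ContDiffAt ℝ ∞ (fun y => Φ y α) x) : MSmoothAt (fun y => A (Φ y)) x :=
  fun i j => (hA i j).comp x (contDiffAt_pi.2 hΦ)

theorem mpd_congr (h : A =ᶠ[𝓝 x] B) : mpd μ A x = mpd μ B x := by
  ext i j
  exact pd_congr (h.mono fun _ hy => congrFun (congrFun hy i) j)

theorem mpd_add (hA : MSmoothAt A x) (hB : MSmoothAt B x) :
    mpd μ (fun y => A y + B y) x = mpd μ A x + mpd μ B x := by
  ext i j
  exact pd_add (smooth_differentiableAt (hA i j)) (smooth_differentiableAt (hB i j))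

theorem mpd_const (C : Mat) : mpd μ (fun _ => C) x = 0 := by
  ext i j
  exact pd_const _

theorem mpd_smul (hf : ContDiffAt ℝ ∞ f x) (hA : MSmoothAt A x) :
    mpd μ (fun y => f y • A y) x = pd μ f x • A x + f x • mpd μ A x := by
  ext i j
  exact pd_mul (smooth_differentiableAt hf) (smooth_differentiableAt (hA i j))

theorem mpd_sum {ι : Type*} {s : Finset ι} {A : ι → R4 → Mat}
    (hA : ∀ i ∈ s, MSmoothAt (A i) x) :
    mpd μ (fun y => ∑ i ∈ s, A i y) x = ∑ i ∈ s, mpd μ (A i) x := by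
  ext i j
  simp only [mpd, Matrix.of_apply, Matrix.sum_apply]
  exact pd_sum s fun k hk => smooth_differentiableAt (hA k hk i j)

theorem mpd_mul (hA : MSmoothAt A x) (hB : MSmoothAt B x) :
    mpd μ (fun y => A y * B y) x = mpd μ A x * B x + A x * mpd μ B x := by
  ext i j
  simp only [mpd, Matrix.of_apply, Matrix.mul_apply, Matrix.add_apply]
  rw [pd_sum _ fun k _ => ((smooth_differentiableAt (hA i k)).fun_mul
    (smooth_differentiableAt (hB k j))), ← Finset.sum_add_distrib]
  exact Finset.sum_congr rfl fun k _ =>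
    pd_mul (smooth_differentiableAt (hA i k)) (smooth_differentiableAt (hB k j))

theorem mpd_comm (hA : MSmoothAt A x) : mpd μ (mpd ν A) x = mpd ν (mpd μ A) x := by
  ext i j
  exact pd_comm (hA i j)

theorem mpd_comp {Φ : R4 → R4} (hA : MSmoothAt A (Φ x))
    (hΦ : ∀ α, ContDiffAt ℝ ∞ (fun y => Φ y α) x) :
    mpd μ (fun y => A (Φ y)) x = ∑ α, pd μ (fun y => Φ y α) x • mpd α A (Φ x) := by
  ext i j
  simp only [mpd, Matrix.of_apply, Matrix.sum_apply, Matrix.smul_apply, smul_eq_mul]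
  exact pd_comp (smooth_differentiableAt (hA i j)) fun α => smooth_differentiableAt (hΦ α)

theorem det_smooth (hA : MSmoothAt A x) : ContDiffAt ℝ ∞ (fun y => (A y).det) x := by
  simp only [Matrix.det_apply, Units.smul_def, zsmul_eq_mul]
  exact ContDiffAt.sum fun σ _ => contDiffAt_const.mul (contDiffAt_prod fun i _ => hA _ _)

theorem inv_smooth (hA : MSmoothAt A x) (h0 : (A x).det ≠ 0) : MSmoothAt (fun y => (A y)⁻¹) x := by
  intro i j
  have h : (fun y => (A y)⁻¹ i j)
      = fun y => ((A y).det)⁻¹ * ((A y).updateRow j (Pi.single i 1)).det := by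
    ext y
    simp [Matrix.inv_def, Matrix.adjugate_apply]
  rw [h]
  refine ((det_smooth hA).inv h0).mul
    (det_smooth (A := fun y => (A y).updateRow j (Pi.single i 1)) ?_)
  intro k l
  by_cases hk : k = j
  · subst hk; simp only [Matrix.updateRow_self]; exact contDiffAt_const
  · simp only [Matrix.updateRow_ne hk]; exact hA k l

/-- Jacobi's formula. -/
theorem pd_det (hA : MSmoothAt A x) :
    pd μ (fun y => (A y).det) x = ((A x).adjugate * mpd μ A x).trace := by
  have h1 : ((A x).adjugate * mpd μ A x).trace
      = ∑ i, ((A x).updateCol i (fun k => mpd μ A x k i)).det := by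
    simp only [Matrix.trace, Matrix.diag_apply]
    refine Finset.sum_congr rfl fun i _ => ?_
    rw [← Matrix.cramer_apply, Matrix.cramer_eq_adjugate_mulVec]
    rfl
  rw [h1]
  simp only [Matrix.det_apply, Units.smul_def, zsmul_eq_mul]
  rw [pd_sum _ fun σ _ => (smooth_differentiableAt
    (contDiffAt_const.mul (contDiffAt_prod fun i _ => hA _ _))), Finset.sum_comm]
  refine Finset.sum_congr rfl fun σ _ => ?_
  rw [pd_const_mul, ← Finset.mul_sum]
  congr 1
  have h2 : ∀ i ∈ (Finset.univ : Finset (Fin 4)), DifferentiableAt ℝ (fun y => A y (σ i) i) x :=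
    fun i _ => smooth_differentiableAt (hA _ _)
  unfold pd
  rw [fderiv_finsetProd h2]
  simp only [FunLike.coe_sum, Finset.sum_apply]
  refine Finset.sum_congr rfl fun i _ => ?_
  rw [← Finset.mul_prod_erase _ _ (Finset.mem_univ i)]
  simp only [Matrix.updateCol_self]
  rw [mul_comm]
  simp only [FunLike.coe_smul, Pi.smul_apply, smul_eq_mul]
  congr 1
  refine Finset.prod_congr rfl fun j hj => ?_
  rw [Matrix.updateCol_ne (Finset.ne_of_mem_erase hj)]

theorem mpd_inv (hA : MSmoothAt A x) (h0 : (A x).det ≠ 0) :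
    mpd μ (fun y => (A y)⁻¹) x = -((A x)⁻¹ * mpd μ A x * (A x)⁻¹) := by
  have hne : ∀ᶠ y in 𝓝 x, (A y).det ≠ 0 := (det_smooth hA).continuousAt.eventually_ne h0
  have h1 : mpd μ (fun y => (A y)⁻¹ * A y) x = 0 := by
    rw [mpd_congr (B := fun _ => 1), mpd_const]
    filter_upwards [hne] with y hy using Matrix.nonsing_inv_mul _ (isUnit_iff_ne_zero.2 hy)
  rw [mpd_mul (inv_smooth hA h0) hA] at h1
  have h2 := congrArg (· * (A x)⁻¹) h1
  simp only [add_mul, zero_mul, Matrix.mul_assoc,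
    Matrix.mul_nonsing_inv _ (isUnit_iff_ne_zero.2 h0), mul_one] at h2
  rw [eq_neg_iff_add_eq_zero, Matrix.mul_assoc]
  exact h2

end MatrixCalculus

/-! ### Matrix-valued connection forms under changes of frame and coordinates -/

/-- The connection coefficients as a matrix-valued one-form: `(θ_μ)^κ_λ = Γ^κ_{μλ}`. -/
def conn (Γ : Coeffs) (μ : Fin 4) (x : R4) : Mat := Matrix.of fun κ lam => Γ x κ μ lam

/-- The curvature `∂_μ θ_ν - ∂_ν θ_μ + [θ_μ, θ_ν]` of a matrix-valued one-form. -/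
def fieldStrength (θ : Fin 4 → R4 → Mat) (μ ν : Fin 4) (x : R4) : Mat :=
  mpd μ (θ ν) x - mpd ν (θ μ) x + (θ μ x * θ ν x - θ ν x * θ μ x)

/-- The gauge-covariant divergence `∑_μ (∂_μ P^{μν} + [θ_μ, P^{μν}])` of a matrix-valued bivector
density; the connection acts on the matrix indices only. -/
def gaugeDiv (θ : Fin 4 → R4 → Mat) (P : Fin 4 → Fin 4 → R4 → Mat) (ν : Fin 4) (x : R4) : Mat :=
  ∑ μ, (mpd μ (P μ ν) x + (θ μ x * P μ ν x - P μ ν x * θ μ x))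

theorem curvature_eq_fieldStrength (Γ : Coeffs) (x : R4) (κ lam μ ν : Fin 4) :
    curvature Γ x κ lam μ ν = fieldStrength (conn Γ) μ ν x κ lam := by
  simp [curvature, fieldStrength, conn, mpd, Matrix.mul_apply, Finset.sum_sub_distrib]

theorem fieldStrength_antisymm (θ : Fin 4 → R4 → Mat) (μ ν : Fin 4) (x : R4) :
    fieldStrength θ μ ν x = -fieldStrength θ ν μ x := by
  unfold fieldStrength; abel

section Gauge

variable {J : R4 → Mat} {θ A : Fin 4 → R4 → Mat} {x : R4}

theorem fieldStrength_smooth (hθ : ∀ μ, MSmoothAt (θ μ) x) (μ ν : Fin 4) :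
    MSmoothAt (fieldStrength θ μ ν) x :=
  ((hθ ν).mpd.sub (hθ μ).mpd).add (((hθ μ).mul (hθ ν)).sub ((hθ ν).mul (hθ μ)))

/-- The curvature transforms by conjugation under the change of frame `J`. -/
theorem fieldStrength_gauge (hJ : MSmoothAt J x) (hθ : ∀ μ, MSmoothAt (θ μ) x)
    (hA : ∀ μ, MSmoothAt (A μ) x)
    (h : ∀ᶠ y in 𝓝 x, ∀ μ, J y * θ μ y = A μ y * J y + mpd μ J y) (μ ν : Fin 4) :
    J x * fieldStrength θ μ ν x = fieldStrength A μ ν x * J x := by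
  have hx := h.self_of_nhds
  have hd : ∀ μ ν, mpd μ J x * θ ν x + J x * mpd μ (θ ν) x
      = (mpd μ (A ν) x * J x + A ν x * mpd μ J x) + mpd μ (mpd ν J) x := by
    intro μ ν
    rw [← mpd_mul hJ (hθ ν), ← mpd_mul (hA ν) hJ, ← mpd_add ((hA ν).mul hJ) hJ.mpd]
    exact mpd_congr (h.mono fun y hy => hy ν)
  have h2 : ∀ μ ν, J x * (θ μ x * θ ν x)
      = A μ x * (A ν x * J x + mpd ν J x) + mpd μ J x * θ ν x := by
    intro μ ν
    rw [← hx ν, ← mul_assoc, hx μ, add_mul, mul_assoc]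
  have h3 : ∀ μ ν, J x * mpd μ (θ ν) x = (mpd μ (A ν) x * J x + A ν x * mpd μ J x)
      + mpd μ (mpd ν J) x - mpd μ J x * θ ν x := by
    intro μ ν
    rw [← hd]; abel
  unfold fieldStrength
  rw [mul_add, mul_sub, mul_sub, h3, h3, h2, h2, mpd_comm (μ := μ) hJ]
  noncomm_ring

/-- The gauge-covariant divergence of an endomorphism-valued density transforms by conjugation
under the change of frame `J`. -/
theorem gaugeDiv_gauge {P Q : Fin 4 → Fin 4 → R4 → Mat} (hJ : MSmoothAt J x)
    (hP : ∀ μ ν, MSmoothAt (P μ ν) x) (hQ : ∀ μ ν, MSmoothAt (Q μ ν) x)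
    (h : ∀ᶠ y in 𝓝 x, ∀ μ, J y * θ μ y = A μ y * J y + mpd μ J y)
    (hPQ : ∀ᶠ y in 𝓝 x, ∀ μ ν, J y * P μ ν y = Q μ ν y * J y) (ν : Fin 4) :
    J x * gaugeDiv θ P ν x = gaugeDiv A Q ν x * J x := by
  have hx := h.self_of_nhds
  have hPx := hPQ.self_of_nhds
  have hd : ∀ μ, J x * mpd μ (P μ ν) x
      = (mpd μ (Q μ ν) x * J x + Q μ ν x * mpd μ J x) - mpd μ J x * P μ ν x := by
    intro μ
    rw [← mpd_mul (hQ μ ν) hJ, eq_sub_iff_add_eq', ← mpd_mul hJ (hP μ ν)]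
    exact mpd_congr (hPQ.mono fun y hy => hy μ ν)
  unfold gaugeDiv
  rw [Finset.mul_sum, Finset.sum_mul]
  refine Finset.sum_congr rfl fun μ _ => ?_
  have h1 : J x * (θ μ x * P μ ν x) = A μ x * (Q μ ν x * J x) + mpd μ J x * P μ ν x := by
    rw [← hPx, ← mul_assoc, hx, add_mul, mul_assoc]
  have h2 : J x * (P μ ν x * θ μ x) = Q μ ν x * (A μ x * J x + mpd μ J x) := by
    rw [← hx, ← mul_assoc, hPx, mul_assoc]
  rw [mul_add, mul_sub, hd, h1, h2]
  noncomm_ring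

end Gauge

/-- The Jacobian matrix `∂Φ^α/∂x^μ`. -/
def jacobian (Φ : R4 → R4) (x : R4) : Mat := Matrix.of fun α μ => pd μ (fun y => Φ y α) x

section Pullback

variable {Φ : R4 → R4} {x : R4}

theorem jacobian_smooth (hΦ : ∀ α, ContDiffAt ℝ ∞ (fun y => Φ y α) x) :
    MSmoothAt (jacobian Φ) x := fun α _ => pd_smooth (hΦ α)

theorem mpd_jacobian_symm (hΦ : ∀ α, ContDiffAt ℝ ∞ (fun y => Φ y α) x) (μ ν α : Fin 4) :
    mpd μ (jacobian Φ) x α ν = mpd ν (jacobian Φ) x α μ := pd_comm (hΦ α)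

/-- The pullback of a matrix-valued one-form, `∑_β (∂Φ^β/∂x^μ) θ_β ∘ Φ`; it acts on the form index
only. -/
def pullback (Φ : R4 → R4) (θ : Fin 4 → R4 → Mat) (μ : Fin 4) (x : R4) : Mat :=
  ∑ β, jacobian Φ x β μ • θ β (Φ x)

variable {θ : Fin 4 → R4 → Mat}

theorem pullback_smooth (hΦ : ∀ α, ContDiffAt ℝ ∞ (fun y => Φ y α) x)
    (hθ : ∀ μ, MSmoothAt (θ μ) (Φ x)) (μ : Fin 4) : MSmoothAt (pullback Φ θ μ) x :=
  MSmoothAt.sum fun β _ => MSmoothAt.smul (jacobian_smooth hΦ β μ) ((hθ β).comp hΦ)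

/-- The curvature commutes with pullback: the second derivatives of `Φ` cancel by symmetry. -/
theorem fieldStrength_pullback (hΦ : ∀ α, ContDiffAt ℝ ∞ (fun y => Φ y α) x)
    (hθ : ∀ μ, MSmoothAt (θ μ) (Φ x)) (μ ν : Fin 4) :
    fieldStrength (pullback Φ θ) μ ν x =
      ∑ α, ∑ β, (jacobian Φ x α μ * jacobian Φ x β ν) • fieldStrength θ α β (Φ x) := by
  have hd : ∀ μ ν, mpd μ (pullback Φ θ ν) x =
      ∑ β, (mpd μ (jacobian Φ) x β ν) • θ β (Φ x)
        + ∑ α, ∑ β, (jacobian Φ x α μ * jacobian Φ x β ν) • mpd α (θ β) (Φ x) := by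
    intro μ ν
    unfold pullback
    rw [mpd_sum fun β _ => MSmoothAt.smul (jacobian_smooth hΦ β ν) ((hθ β).comp hΦ),
      Finset.sum_comm, ← Finset.sum_add_distrib]
    refine Finset.sum_congr rfl fun β _ => ?_
    rw [mpd_smul (jacobian_smooth hΦ β ν) ((hθ β).comp hΦ), mpd_comp (hθ β) hΦ, Finset.smul_sum]
    congr 1
    refine Finset.sum_congr rfl fun α _ => ?_
    rw [smul_smul, mul_comm]
    rfl
  have hm : ∀ μ ν, pullback Φ θ μ x * pullback Φ θ ν x =
      ∑ α, ∑ β, (jacobian Φ x α μ * jacobian Φ x β ν) • (θ α (Φ x) * θ β (Φ x)) := by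
    intro μ ν
    unfold pullback
    rw [Finset.sum_mul]
    refine Finset.sum_congr rfl fun α _ => ?_
    rw [Finset.mul_sum]
    exact Finset.sum_congr rfl fun β _ => smul_mul_smul_comm _ _ _ _
  have hswap : ∀ T : Fin 4 → Fin 4 → Mat,
      ∑ α, ∑ β, (jacobian Φ x α ν * jacobian Φ x β μ) • T α β
        = ∑ α, ∑ β, (jacobian Φ x α μ * jacobian Φ x β ν) • T β α := by
    intro T
    rw [Finset.sum_comm]
    exact Finset.sum_congr rfl fun α _ => Finset.sum_congr rfl fun β _ => by rw [mul_comm]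
  unfold fieldStrength
  rw [hd, hd, hm, hm, hswap, hswap]
  simp only [mpd_jacobian_symm hΦ ν μ, smul_add, smul_sub, Finset.sum_add_distrib,
    Finset.sum_sub_distrib]
  abel

theorem jacobian_inv_smooth (h0 : (jacobian Φ x).det ≠ 0)
    (hΦ : ∀ α, ContDiffAt ℝ ∞ (fun y => Φ y α) x) :
    MSmoothAt (fun y => (jacobian Φ y)⁻¹) x := inv_smooth (jacobian_smooth hΦ) h0

theorem abs_det_smooth (h0 : (jacobian Φ x).det ≠ 0)
    (hΦ : ∀ α, ContDiffAt ℝ ∞ (fun y => Φ y α) x) :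
    ContDiffAt ℝ ∞ (fun y => |(jacobian Φ y).det|) x := (det_smooth (jacobian_smooth hΦ)).abs h0

theorem pd_abs_det (h0 : (jacobian Φ x).det ≠ 0)
    (hΦ : ∀ α, ContDiffAt ℝ ∞ (fun y => Φ y α) x) (μ : Fin 4) :
    pd μ (fun y => |(jacobian Φ y).det|) x =
      |(jacobian Φ x).det| * ((jacobian Φ x)⁻¹ * mpd μ (jacobian Φ) x).trace := by
  have h1 := pd_det (μ := μ) (jacobian_smooth hΦ)
  have h2 : ((jacobian Φ x).adjugate) = (jacobian Φ x).det • (jacobian Φ x)⁻¹ := by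
    rw [Matrix.inv_def, smul_smul, Ring.inverse_eq_inv', mul_inv_cancel₀ h0, one_smul]
  rw [h2, Matrix.smul_mul, Matrix.trace_smul, smul_eq_mul] at h1
  have hd := smooth_differentiableAt (det_smooth (jacobian_smooth hΦ))
  rcases lt_or_gt_of_ne h0 with h | h
  · rw [pd_congr (G := fun y => -(jacobian Φ y).det), pd_neg, h1, abs_of_neg h]
    · ring
    · filter_upwards [hd.continuousAt.eventually_lt_const h] with y hy using abs_of_neg hy
  · rw [pd_congr (G := fun y => (jacobian Φ y).det), h1, abs_of_pos h]
    filter_upwards [hd.continuousAt.eventually_const_lt h] with y hy using abs_of_pos hy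

/-- Piola's identity: up to the sign of the determinant, `|det J| J⁻¹` is the cofactor matrix of the
Jacobian, and it is divergence free. -/
theorem piola (h0 : (jacobian Φ x).det ≠ 0)
    (hΦ : ∀ α, ContDiffAt ℝ ∞ (fun y => Φ y α) x) (α : Fin 4) :
    ∑ μ, pd μ (fun y => |(jacobian Φ y).det| * (jacobian Φ y)⁻¹ μ α) x = 0 := by
  have hK := jacobian_inv_smooth h0 hΦ
  have hD := abs_det_smooth h0 hΦ
  have h1 : ∀ μ, pd μ (fun y => |(jacobian Φ y).det| * (jacobian Φ y)⁻¹ μ α) x =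
      |(jacobian Φ x).det| *
        ((∑ ρ, ∑ β, (jacobian Φ x)⁻¹ ρ β * mpd μ (jacobian Φ) x β ρ * (jacobian Φ x)⁻¹ μ α)
        - ∑ ρ, ∑ β, (jacobian Φ x)⁻¹ μ β * mpd μ (jacobian Φ) x β ρ * (jacobian Φ x)⁻¹ ρ α) := by
    intro μ
    rw [pd_mul (smooth_differentiableAt hD) (smooth_differentiableAt (hK μ α)),
      pd_abs_det h0 hΦ]
    have h2 : pd μ (fun y => (jacobian Φ y)⁻¹ μ α) x
        = -((jacobian Φ x)⁻¹ * mpd μ (jacobian Φ) x * (jacobian Φ x)⁻¹) μ α := by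
      have := mpd_inv (μ := μ) (jacobian_smooth hΦ) h0
      exact congrFun (congrFun this μ) α
    rw [h2]
    simp only [Matrix.trace, Matrix.diag_apply, Matrix.mul_apply, Finset.sum_mul]
    simp only [← Finset.sum_mul, mul_sub]
    ring
  simp only [h1]
  rw [← Finset.mul_sum, Finset.sum_sub_distrib]
  have h3 : ∑ μ, ∑ ρ, ∑ β,
        (jacobian Φ x)⁻¹ ρ β * mpd μ (jacobian Φ) x β ρ * (jacobian Φ x)⁻¹ μ α
      = ∑ μ, ∑ ρ, ∑ β,
        (jacobian Φ x)⁻¹ μ β * mpd μ (jacobian Φ) x β ρ * (jacobian Φ x)⁻¹ ρ α := by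
    rw [Finset.sum_comm]
    simp only [mpd_jacobian_symm hΦ]
  rw [h3, sub_self, mul_zero]

/-- The pullback of a matrix-valued bivector density `P^{αβ}`. The matrix indices are left alone: they
are dealt with by a change of frame. -/
def pullbackDensity (Φ : R4 → R4) (P : Fin 4 → Fin 4 → R4 → Mat) (μ ν : Fin 4) (x : R4) : Mat :=
  ∑ α, ∑ β, (|(jacobian Φ x).det| * (jacobian Φ x)⁻¹ μ α * (jacobian Φ x)⁻¹ ν β) • P α β (Φ x)

end Pullback

/-! ### Divergence of a pulled-back bivector density -/

section PullbackDensity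

variable {Φ : R4 → R4} {x : R4} {θ : Fin 4 → R4 → Mat} {P : Fin 4 → Fin 4 → R4 → Mat}

theorem density_weight_smooth (h0 : (jacobian Φ x).det ≠ 0)
    (hΦ : ∀ α, ContDiffAt ℝ ∞ (fun y => Φ y α) x) (μ ν α β : Fin 4) :
    ContDiffAt ℝ ∞ (fun y => |(jacobian Φ y).det| * (jacobian Φ y)⁻¹ μ α *
      (jacobian Φ y)⁻¹ ν β) x :=
  ((abs_det_smooth h0 hΦ).mul (jacobian_inv_smooth h0 hΦ μ α)).mul (jacobian_inv_smooth h0 hΦ ν β)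

theorem pullbackDensity_smooth (h0 : (jacobian Φ x).det ≠ 0)
    (hΦ : ∀ α, ContDiffAt ℝ ∞ (fun y => Φ y α) x) (hP : ∀ α β, MSmoothAt (P α β) (Φ x))
    (μ ν : Fin 4) : MSmoothAt (pullbackDensity Φ P μ ν) x :=
  MSmoothAt.sum fun α _ => MSmoothAt.sum fun β _ =>
    MSmoothAt.smul (density_weight_smooth h0 hΦ μ ν α β) ((hP α β).comp hΦ)

/-- By Piola's identity only the second factor of the weight `|det J| K^μ_α K^ν_β` (with
`K = J⁻¹`) contributes to its divergence, and that contribution is symmetric in `α` and `β` because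
`∂_μ J^γ_ρ` is symmetric in `μ` and `ρ`. -/
theorem density_weight_div_symm (h0 : (jacobian Φ x).det ≠ 0)
    (hΦ : ∀ α, ContDiffAt ℝ ∞ (fun y => Φ y α) x) (ν α β : Fin 4) :
    ∑ μ, pd μ (fun y => |(jacobian Φ y).det| * (jacobian Φ y)⁻¹ μ α * (jacobian Φ y)⁻¹ ν β) x
      = ∑ μ, pd μ (fun y => |(jacobian Φ y).det| * (jacobian Φ y)⁻¹ μ β *
          (jacobian Φ y)⁻¹ ν α) x := by
  have hK := jacobian_inv_smooth h0 hΦ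
  have hD := abs_det_smooth h0 hΦ
  have key : ∀ α β,
      ∑ μ, pd μ (fun y => |(jacobian Φ y).det| * (jacobian Φ y)⁻¹ μ α * (jacobian Φ y)⁻¹ ν β) x
        = -(|(jacobian Φ x).det| * ∑ μ, ∑ ρ, ∑ γ, (jacobian Φ x)⁻¹ μ α * (jacobian Φ x)⁻¹ ν γ *
            mpd μ (jacobian Φ) x γ ρ * (jacobian Φ x)⁻¹ ρ β) := by
    intro α β
    have h1 : ∀ μ, pd μ (fun y => |(jacobian Φ y).det| * (jacobian Φ y)⁻¹ μ α *
        (jacobian Φ y)⁻¹ ν β) x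
        = pd μ (fun y => |(jacobian Φ y).det| * (jacobian Φ y)⁻¹ μ α) x * (jacobian Φ x)⁻¹ ν β
          - |(jacobian Φ x).det| * ∑ ρ, ∑ γ, (jacobian Φ x)⁻¹ μ α * (jacobian Φ x)⁻¹ ν γ *
            mpd μ (jacobian Φ) x γ ρ * (jacobian Φ x)⁻¹ ρ β := by
      intro μ
      rw [pd_mul (smooth_differentiableAt (hD.mul (hK μ α))) (smooth_differentiableAt (hK ν β))]
      have h2 : pd μ (fun y => (jacobian Φ y)⁻¹ ν β) x
          = -((jacobian Φ x)⁻¹ * mpd μ (jacobian Φ) x * (jacobian Φ x)⁻¹) ν β := by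
        have := mpd_inv (μ := μ) (jacobian_smooth hΦ) h0
        exact congrFun (congrFun this ν) β
      rw [h2]
      simp only [Matrix.mul_apply, Finset.sum_mul, mul_assoc, mul_neg, sub_eq_add_neg,
        Finset.mul_sum]
    simp only [h1]
    rw [Finset.sum_sub_distrib, ← Finset.sum_mul, piola h0 hΦ, zero_mul, zero_sub, Finset.mul_sum]
  rw [key, key, Finset.sum_comm]
  congr 2
  refine Finset.sum_congr rfl fun μ _ => Finset.sum_congr rfl fun ρ _ =>
    Finset.sum_congr rfl fun γ _ => ?_
  rw [mpd_jacobian_symm hΦ]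
  ring

theorem jacobian_mul_inv_apply (h0 : (jacobian Φ x).det ≠ 0) (γ α : Fin 4) :
    ∑ μ, jacobian Φ x γ μ * (jacobian Φ x)⁻¹ μ α = if γ = α then 1 else 0 := by
  rw [← Matrix.mul_apply, Matrix.mul_nonsing_inv _ (isUnit_iff_ne_zero.2 h0), Matrix.one_apply]

/-- The gauge-covariant divergence of an antisymmetric bivector density commutes with pullback. -/
theorem gaugeDiv_pullback (h0 : (jacobian Φ x).det ≠ 0)
    (hΦ : ∀ α, ContDiffAt ℝ ∞ (fun y => Φ y α) x) (hP : ∀ α β, MSmoothAt (P α β) (Φ x))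
    (hanti : ∀ α β, P α β (Φ x) = -P β α (Φ x)) (ν : Fin 4) :
    gaugeDiv (pullback Φ θ) (pullbackDensity Φ P) ν x =
      ∑ β, (|(jacobian Φ x).det| * (jacobian Φ x)⁻¹ ν β) • gaugeDiv θ P β (Φ x) := by
  have hw := density_weight_smooth h0 hΦ
  have hd : ∀ μ, mpd μ (pullbackDensity Φ P μ ν) x =
      ∑ α, ∑ β, pd μ (fun y => |(jacobian Φ y).det| * (jacobian Φ y)⁻¹ μ α *
          (jacobian Φ y)⁻¹ ν β) x • P α β (Φ x)
      + ∑ α, ∑ β, ∑ γ, ((jacobian Φ x γ μ * (jacobian Φ x)⁻¹ μ α) *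
          (|(jacobian Φ x).det| * (jacobian Φ x)⁻¹ ν β)) • mpd γ (P α β) (Φ x) := by
    intro μ
    unfold pullbackDensity
    rw [mpd_sum fun α _ => MSmoothAt.sum fun β _ =>
      MSmoothAt.smul (hw μ ν α β) ((hP α β).comp hΦ), ← Finset.sum_add_distrib]
    refine Finset.sum_congr rfl fun α _ => ?_
    rw [mpd_sum fun β _ => MSmoothAt.smul (hw μ ν α β) ((hP α β).comp hΦ),
      ← Finset.sum_add_distrib]
    refine Finset.sum_congr rfl fun β _ => ?_
    rw [mpd_smul (hw μ ν α β) ((hP α β).comp hΦ), mpd_comp (hP α β) hΦ, Finset.smul_sum]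
    congr 1
    refine Finset.sum_congr rfl fun γ _ => ?_
    rw [smul_smul]
    congr 1
    change _ * jacobian Φ x γ μ = _
    ring
  have hzero : ∑ μ, ∑ α, ∑ β, pd μ (fun y => |(jacobian Φ y).det| * (jacobian Φ y)⁻¹ μ α *
          (jacobian Φ y)⁻¹ ν β) x • P α β (Φ x) = 0 := by
    have h1 : ∀ s : Fin 4 → Fin 4 → ℝ, (∀ α β, s α β = s β α) →
        ∑ α, ∑ β, s α β • P α β (Φ x) = 0 := by
      intro s hs
      have h2 : ∑ α, ∑ β, s α β • P α β (Φ x) = -∑ α, ∑ β, s α β • P α β (Φ x) := by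
        conv_lhs => rw [Finset.sum_comm]
        rw [← Finset.sum_neg_distrib]
        refine Finset.sum_congr rfl fun α _ => ?_
        rw [← Finset.sum_neg_distrib]
        refine Finset.sum_congr rfl fun β _ => ?_
        rw [hs, hanti, smul_neg]
      ext i j
      have h3 := congrFun (congrFun h2 i) j
      rw [Matrix.neg_apply] at h3
      rw [Matrix.zero_apply]
      linarith
    rw [← h1 _ (density_weight_div_symm h0 hΦ ν), Finset.sum_comm]
    refine Finset.sum_congr rfl fun α _ => ?_
    rw [Finset.sum_comm]
    exact Finset.sum_congr rfl fun β _ => (Finset.sum_smul ..).symm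
  have hδ : ∀ (T : Fin 4 → Fin 4 → Fin 4 → Mat),
      ∑ μ, ∑ α, ∑ β, ∑ γ, ((jacobian Φ x γ μ * (jacobian Φ x)⁻¹ μ α) *
          (|(jacobian Φ x).det| * (jacobian Φ x)⁻¹ ν β)) • T γ α β
        = ∑ β, (|(jacobian Φ x).det| * (jacobian Φ x)⁻¹ ν β) • ∑ α, T α α β := by
    intro T
    have h1 : ∀ α β γ, ∑ μ, ((jacobian Φ x γ μ * (jacobian Φ x)⁻¹ μ α) *
          (|(jacobian Φ x).det| * (jacobian Φ x)⁻¹ ν β)) • T γ α β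
        = if γ = α then (|(jacobian Φ x).det| * (jacobian Φ x)⁻¹ ν β) • T γ α β else 0 := by
      intro α β γ
      rw [← Finset.sum_smul, ← Finset.sum_mul, jacobian_mul_inv_apply h0]
      split_ifs <;> simp
    rw [Finset.sum_comm]
    simp only [Finset.smul_sum]
    rw [Finset.sum_comm (γ := Fin 4) (s := Finset.univ (α := Fin 4)) (t := Finset.univ)
      (f := fun β α => (|(jacobian Φ x).det| * (jacobian Φ x)⁻¹ ν β) • T α α β)]
    refine Finset.sum_congr rfl fun α _ => ?_
    rw [Finset.sum_comm]
    refine Finset.sum_congr rfl fun β _ => ?_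
    rw [Finset.sum_comm]
    simp only [h1, Finset.sum_ite_eq', Finset.mem_univ, if_true]
  have hc : ∀ μ, pullback Φ θ μ x * pullbackDensity Φ P μ ν x
        - pullbackDensity Φ P μ ν x * pullback Φ θ μ x
      = ∑ α, ∑ β, ∑ γ, ((jacobian Φ x γ μ * (jacobian Φ x)⁻¹ μ α) *
          (|(jacobian Φ x).det| * (jacobian Φ x)⁻¹ ν β)) •
            (θ γ (Φ x) * P α β (Φ x) - P α β (Φ x) * θ γ (Φ x)) := by
    intro μ
    have h1 : pullback Φ θ μ x * pullbackDensity Φ P μ ν x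
        = ∑ α, ∑ β, ∑ γ, ((jacobian Φ x γ μ * (jacobian Φ x)⁻¹ μ α) *
          (|(jacobian Φ x).det| * (jacobian Φ x)⁻¹ ν β)) • (θ γ (Φ x) * P α β (Φ x)) := by
      unfold pullback pullbackDensity
      simp only [Finset.mul_sum, Finset.sum_mul, smul_mul_smul_comm]
      refine Finset.sum_congr rfl fun α _ => Finset.sum_congr rfl fun β _ =>
        Finset.sum_congr rfl fun γ _ => ?_
      congr 1
      ring
    have h2 : pullbackDensity Φ P μ ν x * pullback Φ θ μ x
        = ∑ α, ∑ β, ∑ γ, ((jacobian Φ x γ μ * (jacobian Φ x)⁻¹ μ α) *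
          (|(jacobian Φ x).det| * (jacobian Φ x)⁻¹ ν β)) • (P α β (Φ x) * θ γ (Φ x)) := by
      unfold pullback pullbackDensity
      rw [Finset.sum_mul]
      refine Finset.sum_congr rfl fun α _ => ?_
      rw [Finset.sum_mul]
      refine Finset.sum_congr rfl fun β _ => ?_
      rw [Finset.mul_sum]
      refine Finset.sum_congr rfl fun γ _ => ?_
      rw [smul_mul_smul_comm]
      congr 1
      ring
    simp only [h1, h2, smul_sub, Finset.sum_sub_distrib]
  have hg : ∀ β, gaugeDiv θ P β (Φ x) = ∑ α, mpd α (P α β) (Φ x)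
      + ∑ α, (θ α (Φ x) * P α β (Φ x) - P α β (Φ x) * θ α (Φ x)) := by
    intro β
    unfold gaugeDiv
    rw [← Finset.sum_add_distrib]
  simp only [hg, smul_add, Finset.sum_add_distrib]
  rw [← hδ fun γ α β => mpd γ (P α β) (Φ x),
    ← hδ fun γ α β => θ γ (Φ x) * P α β (Φ x) - P α β (Φ x) * θ γ (Φ x)]
  have h2 : gaugeDiv (pullback Φ θ) (pullbackDensity Φ P) ν x
      = ∑ μ, mpd μ (pullbackDensity Φ P μ ν) x
        + ∑ μ, (pullback Φ θ μ x * pullbackDensity Φ P μ ν x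
          - pullbackDensity Φ P μ ν x * pullback Φ θ μ x) := by
    unfold gaugeDiv
    rw [← Finset.sum_add_distrib]
  rw [h2]
  simp only [hd, hc, Finset.sum_add_distrib, hzero, zero_add]

end PullbackDensity

/-! ### The Yang-Mills field density -/

/-- The bivector density `P^{μν} = √|det g| R^{μν}` with values in matrices. -/
def fieldDensity (g : TwoTensor) (θ : Fin 4 → R4 → Mat) (μ ν : Fin 4) (x : R4) : Mat :=
  ∑ α, ∑ β, (Real.sqrt |(g x).det| * (g x)⁻¹ μ α * (g x)⁻¹ ν β) • fieldStrength θ α β x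

section FieldDensity

variable {g : TwoTensor} {θ : Fin 4 → R4 → Mat} {x : R4}

theorem sqrt_abs_det_smooth (hg : MSmoothAt g x) (h0 : (g x).det ≠ 0) :
    ContDiffAt ℝ ∞ (fun y => Real.sqrt |(g y).det|) x :=
  ((det_smooth hg).abs h0).sqrt (abs_ne_zero.2 h0)

theorem fieldDensity_smooth (hg : MSmoothAt g x) (h0 : (g x).det ≠ 0)
    (hθ : ∀ μ, MSmoothAt (θ μ) x) (μ ν : Fin 4) : MSmoothAt (fieldDensity g θ μ ν) x :=
  MSmoothAt.sum fun α _ => MSmoothAt.sum fun β _ => MSmoothAt.smul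
    (((sqrt_abs_det_smooth hg h0).mul (inv_smooth hg h0 μ α)).mul (inv_smooth hg h0 ν β))
    (fieldStrength_smooth hθ α β)

theorem fieldDensity_antisymm (μ ν : Fin 4) :
    fieldDensity g θ μ ν x = -fieldDensity g θ ν μ x := by
  unfold fieldDensity
  rw [Finset.sum_comm, ← Finset.sum_neg_distrib]
  refine Finset.sum_congr rfl fun α _ => ?_
  rw [← Finset.sum_neg_distrib]
  refine Finset.sum_congr rfl fun β _ => ?_
  rw [fieldStrength_antisymm, smul_neg]
  congr 2
  ring

theorem sum_smul_sum_smul (a b : Fin 4 → ℝ) (c d : Fin 4 → Fin 4 → ℝ) (T : Fin 4 → Fin 4 → Mat) :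
    ∑ α, ∑ β, (a α * b β) • ∑ γ, ∑ δ, (c γ α * d δ β) • T γ δ
      = ∑ γ, ∑ δ, ((∑ α, a α * c γ α) * ∑ β, b β * d δ β) • T γ δ := by
  have h : ∀ γ δ, ((∑ α, a α * c γ α) * ∑ β, b β * d δ β) • T γ δ
      = ∑ α, ∑ β, (a α * b β) • (c γ α * d δ β) • T γ δ := by
    intro γ δ
    simp only [Finset.sum_mul_sum, Finset.sum_smul, smul_smul]
    refine Finset.sum_congr rfl fun α _ => Finset.sum_congr rfl fun β _ => ?_
    congr 1
    ring
  simp only [h, Finset.smul_sum]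
  calc _ = ∑ α, ∑ γ, ∑ β, ∑ δ, (a α * b β) • (c γ α * d δ β) • T γ δ :=
        Finset.sum_congr rfl fun α _ => Finset.sum_comm
    _ = ∑ γ, ∑ α, ∑ β, ∑ δ, (a α * b β) • (c γ α * d δ β) • T γ δ := Finset.sum_comm
    _ = ∑ γ, ∑ α, ∑ δ, ∑ β, (a α * b β) • (c γ α * d δ β) • T γ δ :=
        Finset.sum_congr rfl fun γ _ => Finset.sum_congr rfl fun α _ => Finset.sum_comm
    _ = _ := Finset.sum_congr rfl fun γ _ => Finset.sum_comm

/-- The field density transforms as a bivector density with values in endomorphisms. -/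
theorem fieldDensity_change {Φ : R4 → R4} {g' : TwoTensor} {θ' : Fin 4 → R4 → Mat}
    (h0 : (jacobian Φ x).det ≠ 0) (hg : g x = (jacobian Φ x).transpose * g' (Φ x) * jacobian Φ x)
    (hF : ∀ μ ν, jacobian Φ x * fieldStrength θ μ ν x
      = (∑ α, ∑ β, (jacobian Φ x α μ * jacobian Φ x β ν) • fieldStrength θ' α β (Φ x))
        * jacobian Φ x) (μ ν : Fin 4) :
    jacobian Φ x * fieldDensity g θ μ ν x
      = pullbackDensity Φ (fieldDensity g' θ') μ ν x * jacobian Φ x := by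
  set J := jacobian Φ x with hJ
  have hu : IsUnit J.det := isUnit_iff_ne_zero.2 h0
  have hdet : Real.sqrt |(g x).det| = |J.det| * Real.sqrt |(g' (Φ x)).det| := by
    rw [hg, Matrix.det_mul, Matrix.det_mul, Matrix.det_transpose, abs_mul, abs_mul,
      show |J.det| * |(g' (Φ x)).det| * |J.det| = |J.det| ^ 2 * |(g' (Φ x)).det| by ring,
      Real.sqrt_mul (by positivity), Real.sqrt_sq (abs_nonneg _)]
  have hinv : (g x)⁻¹ * J.transpose = J⁻¹ * (g' (Φ x))⁻¹ := by
    rw [hg, Matrix.mul_inv_rev, Matrix.mul_inv_rev, ← Matrix.transpose_nonsing_inv, mul_assoc,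
      mul_assoc, ← Matrix.transpose_mul, Matrix.mul_nonsing_inv _ hu, Matrix.transpose_one, mul_one]
  have hinv' : ∀ μ γ, ∑ α, (g x)⁻¹ μ α * J γ α = ∑ ε, J⁻¹ μ ε * (g' (Φ x))⁻¹ ε γ := by
    intro μ γ
    have := congrFun (congrFun hinv μ) γ
    simpa only [Matrix.mul_apply, Matrix.transpose_apply] using this
  unfold fieldDensity
  have hl : J * (∑ α, ∑ β, (Real.sqrt |(g x).det| * (g x)⁻¹ μ α * (g x)⁻¹ ν β) •
      fieldStrength θ α β x) = (∑ α, ∑ β, (Real.sqrt |(g x).det| * (g x)⁻¹ μ α * (g x)⁻¹ ν β) •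
        ∑ γ, ∑ δ, (J γ α * J δ β) • fieldStrength θ' γ δ (Φ x)) * J := by
    simp only [Finset.mul_sum, Matrix.mul_smul, hF]
    simp only [← Matrix.smul_mul, ← Finset.sum_mul]
  rw [hl, sum_smul_sum_smul (fun α => Real.sqrt |(g x).det| * (g x)⁻¹ μ α)
    (fun β => (g x)⁻¹ ν β) J J (fun γ δ => fieldStrength θ' γ δ (Φ x))]
  unfold pullbackDensity
  rw [sum_smul_sum_smul (fun α => |J.det| * J⁻¹ μ α) (fun β => J⁻¹ ν β)
    (fun γ α => Real.sqrt |(g' (Φ x)).det| * (g' (Φ x))⁻¹ α γ)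
    (fun δ β => (g' (Φ x))⁻¹ β δ) (fun γ δ => fieldStrength θ' γ δ (Φ x))]
  congr 1
  refine Finset.sum_congr rfl fun γ _ => Finset.sum_congr rfl fun δ _ => ?_
  congr 1
  simp only [mul_assoc, ← Finset.mul_sum]
  rw [hinv', hinv', hdet]
  simp only [mul_left_comm _ (Real.sqrt _), ← Finset.mul_sum]
  ring

end FieldDensity

/-! ### The first variation of the Yang-Mills action -/

section FirstVariation

open MeasureTheory


/-- The divergence theorem for a compactly supported function. -/
theorem integral_pd_eq_zero {V : R4 → ℝ} (hV : ContDiff ℝ ∞ V) (hc : HasCompactSupport V)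
    (μ : Fin 4) : ∫ x, pd μ V x = 0 := by
  have hd : Continuous (pd μ V) :=
    (hV.continuous_fderiv (by simp)).clm_apply continuous_const
  have hdc : HasCompactSupport (pd μ V) :=
    (hc.fderiv ℝ).comp_left (g := fun L : R4 →L[ℝ] ℝ => L (Pi.single μ 1)) rfl
  have hi : Integrable (fun x => fderiv ℝ V x (Pi.single μ 1)) :=
    hd.integrable_of_hasCompactSupport hdc
  have h := integral_mul_fderiv_eq_neg_fderiv_mul_of_integrable (μ := (volume : Measure R4))
    (f := fun _ : R4 => (1 : ℝ)) (g := V) (v := Pi.single μ 1)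
    (by simp) (by simpa using hi)
    (by simpa using hV.continuous.integrable_of_hasCompactSupport hc)
    (fun _ _ => differentiableAt_const _) (fun _ _ => hV.differentiable (by simp) _)
  simpa [pd] using h

/-- The polarisation of the Yang-Mills quadratic form. -/
def yangMillsForm (g : TwoTensor) (x : R4) (X Y : Fin 4 → Fin 4 → Mat) : ℝ :=
  ∑ μ, ∑ ν, ∑ α, ∑ β, (g x)⁻¹ μ α * (g x)⁻¹ ν β * (X μ ν * Y α β).trace

theorem yangMills_eq (g : TwoTensor) (Γ : Coeffs) (x : R4) :
    yangMills g Γ x = yangMillsForm g x (fun μ ν => fieldStrength (conn Γ) μ ν x)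
      (fun μ ν => fieldStrength (conn Γ) μ ν x) := by
  have hcomm : ∀ T : Fin 4 → Fin 4 → Fin 4 → Fin 4 → Fin 4 → ℝ,
      ∑ κ, ∑ μ, ∑ ν, ∑ α, ∑ β, T κ μ ν α β = ∑ μ, ∑ ν, ∑ α, ∑ β, ∑ κ, T κ μ ν α β := by
    intro T
    rw [Finset.sum_comm]
    refine Finset.sum_congr rfl fun μ _ => ?_
    rw [Finset.sum_comm]
    refine Finset.sum_congr rfl fun ν _ => ?_
    rw [Finset.sum_comm]
    refine Finset.sum_congr rfl fun α _ => ?_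
    rw [Finset.sum_comm]
  unfold yangMills yangMillsForm
  simp only [curvature_eq_fieldStrength, Matrix.trace, Matrix.diag_apply, Matrix.mul_apply]
  rw [Finset.sum_congr rfl fun κ _ => hcomm _, hcomm]
  refine Finset.sum_congr rfl fun μ _ => Finset.sum_congr rfl fun ν _ =>
    Finset.sum_congr rfl fun α _ => Finset.sum_congr rfl fun β _ => ?_
  rw [Finset.mul_sum]
  refine Finset.sum_congr rfl fun κ _ => ?_
  rw [Finset.mul_sum]
  exact Finset.sum_congr rfl fun lam _ => mul_comm _ _

section Form

variable {g : TwoTensor} {x : R4} {X Y Z : Fin 4 → Fin 4 → Mat}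

theorem yangMillsForm_add_left :
    yangMillsForm g x (fun μ ν => X μ ν + Y μ ν) Z
      = yangMillsForm g x X Z + yangMillsForm g x Y Z := by
  simp only [yangMillsForm, add_mul, Matrix.trace_add, mul_add, Finset.sum_add_distrib]

theorem yangMillsForm_smul_left (t : ℝ) :
    yangMillsForm g x (fun μ ν => t • X μ ν) Z = t * yangMillsForm g x X Z := by
  simp only [yangMillsForm, Matrix.smul_mul, Matrix.trace_smul, smul_eq_mul, Finset.mul_sum]
  refine Finset.sum_congr rfl fun μ _ => Finset.sum_congr rfl fun ν _ =>
    Finset.sum_congr rfl fun α _ => Finset.sum_congr rfl fun β _ => ?_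
  ring

theorem yangMillsForm_comm (hg : (g x).IsSymm) :
    yangMillsForm g x X Y = yangMillsForm g x Y X := by
  have hs : ∀ i j, (g x)⁻¹ i j = (g x)⁻¹ j i := by
    intro i j
    have h : ((g x)⁻¹).transpose = (g x)⁻¹ := by rw [Matrix.transpose_nonsing_inv, hg.eq]
    exact (congrFun (congrFun h i) j).symm
  unfold yangMillsForm
  calc _ = ∑ μ, ∑ α, ∑ ν, ∑ β, (g x)⁻¹ μ α * (g x)⁻¹ ν β * (X μ ν * Y α β).trace :=
        Finset.sum_congr rfl fun μ _ => Finset.sum_comm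
    _ = ∑ α, ∑ μ, ∑ ν, ∑ β, (g x)⁻¹ μ α * (g x)⁻¹ ν β * (X μ ν * Y α β).trace := Finset.sum_comm
    _ = ∑ α, ∑ μ, ∑ β, ∑ ν, (g x)⁻¹ μ α * (g x)⁻¹ ν β * (X μ ν * Y α β).trace :=
        Finset.sum_congr rfl fun α _ => Finset.sum_congr rfl fun μ _ => Finset.sum_comm
    _ = ∑ α, ∑ β, ∑ μ, ∑ ν, (g x)⁻¹ μ α * (g x)⁻¹ ν β * (X μ ν * Y α β).trace :=
        Finset.sum_congr rfl fun α _ => Finset.sum_comm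
    _ = _ := by
        refine Finset.sum_congr rfl fun α _ => Finset.sum_congr rfl fun β _ =>
          Finset.sum_congr rfl fun μ _ => Finset.sum_congr rfl fun ν _ => ?_
        rw [hs μ α, hs ν β, Matrix.trace_mul_comm]

theorem yangMillsForm_smooth {X Y : Fin 4 → Fin 4 → R4 → Mat} (hg : MSmoothAt g x)
    (h0 : (g x).det ≠ 0) (hX : ∀ μ ν, MSmoothAt (X μ ν) x) (hY : ∀ μ ν, MSmoothAt (Y μ ν) x) :
    ContDiffAt ℝ ∞ (fun y => yangMillsForm g y (fun μ ν => X μ ν y) (fun μ ν => Y μ ν y)) x := by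
  have hi := inv_smooth hg h0
  refine ContDiffAt.sum fun μ _ => ContDiffAt.sum fun ν _ => ContDiffAt.sum fun α _ =>
    ContDiffAt.sum fun β _ => ((hi _ _).mul (hi _ _)).mul ?_
  exact ContDiffAt.sum fun i _ => (hX μ ν).mul (hY α β) i i

end Form

/-- If the products of any two curvature components are traceless, then the Yang-Mills integrand
vanishes for every metric. -/
theorem metricStationary_of_trace_eq_zero {U : Set R4} {g : TwoTensor} {Γ : Coeffs}
    (htr : ∀ x ∈ U, ∀ μ ν α β,
      (fieldStrength (conn Γ) μ ν x * fieldStrength (conn Γ) α β x).trace = 0) :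
    MetricStationary U g Γ := by
  intro K h _ hKU _ _ _
  have hz : (fun t : ℝ => action K (fun x => g x + t • h x) Γ) = fun _ => 0 := by
    funext t
    refine setIntegral_eq_zero_of_forall_eq_zero fun x hx => ?_
    rw [yangMills_eq]
    simp [yangMillsForm, htr x (hKU hx)]
  rw [hz]
  exact hasDerivAt_const _ _

/-- The covariant exterior derivative of a variation `η` of the connection form `θ`, which is the
first-order variation of the curvature. -/
def linearisedCurvature (θ η : Fin 4 → R4 → Mat) (μ ν : Fin 4) (x : R4) : Mat :=
  mpd μ (η ν) x - mpd ν (η μ) x + (θ μ x * η ν x - η ν x * θ μ x)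
    - (θ ν x * η μ x - η μ x * θ ν x)

section Variation

variable {θ η : Fin 4 → R4 → Mat} {x : R4}

theorem fieldStrength_add_smul (hθ : ∀ μ, MSmoothAt (θ μ) x) (hη : ∀ μ, MSmoothAt (η μ) x)
    (t : ℝ) (μ ν : Fin 4) :
    fieldStrength (fun μ y => θ μ y + t • η μ y) μ ν x = fieldStrength θ μ ν x
      + t • (linearisedCurvature θ η μ ν x + t • (η μ x * η ν x - η ν x * η μ x)) := by
  have hd : ∀ μ ν, mpd μ (fun y => θ ν y + t • η ν y) x = mpd μ (θ ν) x + t • mpd μ (η ν) x := by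
    intro μ ν
    rw [mpd_add (hθ ν) (MSmoothAt.smul contDiffAt_const (hη ν)),
      mpd_smul contDiffAt_const (hη ν), pd_const, zero_smul, zero_add]
  unfold fieldStrength linearisedCurvature
  rw [hd, hd]
  simp only [add_mul, mul_add, Matrix.smul_mul, Matrix.mul_smul]
  module

theorem linearisedCurvature_smooth (hθ : ∀ μ, MSmoothAt (θ μ) x) (hη : ∀ μ, MSmoothAt (η μ) x)
    (μ ν : Fin 4) : MSmoothAt (linearisedCurvature θ η μ ν) x :=
  (((hη ν).mpd.sub (hη μ).mpd).add (((hθ μ).mul (hη ν)).sub ((hη ν).mul (hθ μ)))).sub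
    (((hθ ν).mul (hη μ)).sub ((hη μ).mul (hθ ν)))

/-- Under the Yang-Mills equation the first variation of the integrand is a divergence. -/
theorem first_variation_eq_divergence {g : TwoTensor} (hg : MSmoothAt g x) (h0 : (g x).det ≠ 0)
    (hθ : ∀ μ, MSmoothAt (θ μ) x) (hη : ∀ μ, MSmoothAt (η μ) x)
    (hYM : ∀ ν, gaugeDiv θ (fieldDensity g θ) ν x = 0) :
    yangMillsForm g x (fun μ ν => linearisedCurvature θ η μ ν x)
        (fun μ ν => fieldStrength θ μ ν x) * Real.sqrt |(g x).det|
      = ∑ μ, ∑ ν, 2 * pd μ (fun y => (η ν y * fieldDensity g θ μ ν y).trace) x := by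
  have h1 : yangMillsForm g x (fun μ ν => linearisedCurvature θ η μ ν x)
        (fun μ ν => fieldStrength θ μ ν x) * Real.sqrt |(g x).det|
      = ∑ μ, ∑ ν, (linearisedCurvature θ η μ ν x * fieldDensity g θ μ ν x).trace := by
    unfold yangMillsForm fieldDensity
    simp only [Finset.sum_mul, Finset.mul_sum, Matrix.trace_sum, Matrix.mul_smul,
      Matrix.trace_smul, smul_eq_mul]
    refine Finset.sum_congr rfl fun μ _ => Finset.sum_congr rfl fun ν _ =>
      Finset.sum_congr rfl fun α _ => Finset.sum_congr rfl fun β _ => ?_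
    ring
  have h2 : ∑ μ, ∑ ν, (linearisedCurvature θ η μ ν x * fieldDensity g θ μ ν x).trace
      = ∑ μ, ∑ ν, 2 * ((mpd μ (η ν) x + (θ μ x * η ν x - η ν x * θ μ x))
          * fieldDensity g θ μ ν x).trace := by
    have h3 : ∀ μ ν, (linearisedCurvature θ η μ ν x * fieldDensity g θ μ ν x).trace
        = ((mpd μ (η ν) x + (θ μ x * η ν x - η ν x * θ μ x)) * fieldDensity g θ μ ν x).trace
        + ((mpd ν (η μ) x + (θ ν x * η μ x - η μ x * θ ν x)) * fieldDensity g θ ν μ x).trace := by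
      intro μ ν
      rw [fieldDensity_antisymm ν μ, ← Matrix.trace_add, mul_neg, ← sub_eq_add_neg, ← sub_mul]
      congr 2
      unfold linearisedCurvature
      abel
    simp only [h3, Finset.sum_add_distrib]
    conv_lhs => rw [add_comm, Finset.sum_comm]
    simp only [← Finset.mul_sum]
    ring
  have h4 : ∀ μ ν, ((mpd μ (η ν) x + (θ μ x * η ν x - η ν x * θ μ x))
          * fieldDensity g θ μ ν x).trace
      = pd μ (fun y => (η ν y * fieldDensity g θ μ ν y).trace) x
        - (η ν x * (mpd μ (fieldDensity g θ μ ν) x + (θ μ x * fieldDensity g θ μ ν x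
            - fieldDensity g θ μ ν x * θ μ x))).trace := by
    intro μ ν
    have hP := fieldDensity_smooth hg h0 hθ μ ν
    have h5 : pd μ (fun y => (η ν y * fieldDensity g θ μ ν y).trace) x
        = (mpd μ (fun y => η ν y * fieldDensity g θ μ ν y) x).trace :=
      pd_sum _ fun i _ => smooth_differentiableAt ((hη ν).mul hP i i)
    have h6 : (θ μ x * (η ν x * fieldDensity g θ μ ν x)).trace
        = (η ν x * (fieldDensity g θ μ ν x * θ μ x)).trace := by
      rw [Matrix.trace_mul_comm, mul_assoc]
    rw [h5, mpd_mul (hη ν) hP]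
    simp only [add_mul, sub_mul, mul_add, mul_sub, Matrix.trace_add, Matrix.trace_sub, mul_assoc,
      h6]
    ring
  have h7 : ∑ μ, ∑ ν, (η ν x * (mpd μ (fieldDensity g θ μ ν) x + (θ μ x * fieldDensity g θ μ ν x
            - fieldDensity g θ μ ν x * θ μ x))).trace = 0 := by
    rw [Finset.sum_comm]
    refine Finset.sum_eq_zero fun ν _ => ?_
    rw [← Matrix.trace_sum, ← Finset.mul_sum]
    have := hYM ν
    unfold gaugeDiv at this
    rw [this, mul_zero, Matrix.trace_zero]
  rw [h1, h2]
  simp only [h4, mul_sub, Finset.sum_sub_distrib]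
  rw [sub_eq_self]
  simp only [← Finset.mul_sum]
  rw [h7, mul_zero]

end Variation

theorem hasDerivAt_setIntegral_polynomial {K : Set R4} {φ : ℝ → R4 → ℝ} {c₁ c₂ c₃ c₄ : R4 → ℝ}
    (hK : MeasurableSet K)
    (h₁ : IntegrableOn c₁ K) (h₂ : IntegrableOn c₂ K) (h₃ : IntegrableOn c₃ K)
    (h₄ : IntegrableOn c₄ K)
    (hφ : ∀ t, ∀ x ∈ K, φ t x = t * c₁ x + t ^ 2 * c₂ x + t ^ 3 * c₃ x + t ^ 4 * c₄ x) :
    HasDerivAt (fun t => ∫ x in K, φ t x) (∫ x in K, c₁ x) 0 := by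
  have h : (fun t => ∫ x in K, φ t x) = fun t => t * (∫ x in K, c₁ x) + t ^ 2 * (∫ x in K, c₂ x)
      + t ^ 3 * (∫ x in K, c₃ x) + t ^ 4 * ∫ x in K, c₄ x := by
    funext t
    rw [setIntegral_congr_fun hK (hφ t), integral_add, integral_add, integral_add]
    · simp only [integral_const_mul]
    · exact h₁.const_mul _
    · exact h₂.const_mul _
    · exact (h₁.const_mul _).add (h₂.const_mul _)
    · exact h₃.const_mul _
    · exact ((h₁.const_mul _).add (h₂.const_mul _)).add (h₃.const_mul _)
    · exact h₄.const_mul _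
  rw [h]
  have := ((((hasDerivAt_id (0 : ℝ)).mul_const (∫ x in K, c₁ x)).add
    (((hasDerivAt_id (0 : ℝ)).pow 2).mul_const (∫ x in K, c₂ x))).add
    (((hasDerivAt_id (0 : ℝ)).pow 3).mul_const (∫ x in K, c₃ x))).add
    (((hasDerivAt_id (0 : ℝ)).pow 4).mul_const (∫ x in K, c₄ x))
  refine (this.congr_deriv ?_)
  simp

/-- Stationarity under variations of the connection, from the Yang-Mills equation. -/
theorem connectionStationary_of_yangMills {U : Set R4} {g : TwoTensor} {Γ : Coeffs}
    (hg : ∀ x ∈ U, MSmoothAt g x) (hsymm : ∀ x ∈ U, (g x).IsSymm)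
    (h0 : ∀ x ∈ U, (g x).det ≠ 0) (hΓ : ∀ x ∈ U, ∀ μ, MSmoothAt (conn Γ μ) x)
    (htr : ∀ x ∈ U, ∀ μ ν α β,
      (fieldStrength (conn Γ) μ ν x * fieldStrength (conn Γ) α β x).trace = 0)
    (hYM : ∀ x ∈ U, ∀ ν, gaugeDiv (conn Γ) (fieldDensity g (conn Γ)) ν x = 0) :
    ConnectionStationary U g Γ := by
  intro K δ hK hKU hδ hsupp
  have hη : ∀ x μ, MSmoothAt (conn δ μ) x := fun x μ κ lam => (hδ κ μ lam).contDiffAt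
  set θ := conn Γ with hθ
  set η := conn δ with hηdef
  set F : R4 → Fin 4 → Fin 4 → Mat := fun x μ ν => fieldStrength θ μ ν x with hF
  set D : R4 → Fin 4 → Fin 4 → Mat := fun x μ ν => linearisedCurvature θ η μ ν x with hD
  set C : R4 → Fin 4 → Fin 4 → Mat := fun x μ ν => η μ x * η ν x - η ν x * η μ x with hC
  set w : R4 → ℝ := fun x => Real.sqrt |(g x).det| with hw
  have hFs : ∀ x ∈ U, ∀ μ ν, MSmoothAt (fun y => F y μ ν) x :=
    fun x hx => fieldStrength_smooth (hΓ x hx)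
  have hDs : ∀ x ∈ U, ∀ μ ν, MSmoothAt (fun y => D y μ ν) x :=
    fun x hx => linearisedCurvature_smooth (hΓ x hx) (hη x)
  have hCs : ∀ x ∈ U, ∀ μ ν, MSmoothAt (fun y => C y μ ν) x :=
    fun x _ μ ν => ((hη x μ).mul (hη x ν)).sub ((hη x ν).mul (hη x μ))
  have hint : ∀ {X Y : R4 → Fin 4 → Fin 4 → Mat},
      (∀ x ∈ U, ∀ μ ν, MSmoothAt (fun y => X y μ ν) x) →
      (∀ x ∈ U, ∀ μ ν, MSmoothAt (fun y => Y y μ ν) x) →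
      IntegrableOn (fun x => yangMillsForm g x (X x) (Y x) * w x) K := by
    intro X Y hX hY
    refine ContinuousOn.integrableOn_compact hK fun x hx => ContinuousAt.continuousWithinAt ?_
    exact ((yangMillsForm_smooth (hg x (hKU hx)) (h0 x (hKU hx)) (hX x (hKU hx))
      (hY x (hKU hx))).mul (sqrt_abs_det_smooth (hg x (hKU hx)) (h0 x (hKU hx)))).continuousAt
  -- the constant term `yangMillsForm g x (F x) (F x)` is absent because of `htr`
  have hexp : ∀ t : ℝ, ∀ x ∈ K, yangMills g (fun x => Γ x + t • δ x) x * w x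
      = t * (2 * (yangMillsForm g x (D x) (F x) * w x))
        + t ^ 2 * (2 * (yangMillsForm g x (C x) (F x) * w x)
            + yangMillsForm g x (D x) (D x) * w x)
        + t ^ 3 * (2 * (yangMillsForm g x (C x) (D x) * w x))
        + t ^ 4 * (yangMillsForm g x (C x) (C x) * w x) := by
    intro t x hx
    have hs := hsymm x (hKU hx)
    have hc : conn (fun x => Γ x + t • δ x) = fun μ y => θ μ y + t • η μ y := by
      funext μ y
      ext κ lam
      simp [conn, hθ, hηdef]
    have hFF : yangMillsForm g x (F x) (F x) = 0 := by
      simp [yangMillsForm, hF, htr x (hKU hx)]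
    have hr : ∀ {X Y Z}, yangMillsForm g x Z (fun μ ν => X μ ν + Y μ ν)
        = yangMillsForm g x X Z + yangMillsForm g x Y Z := by
      intro X Y Z
      rw [yangMillsForm_comm hs, yangMillsForm_add_left]
    have hr' : ∀ {X Z}, yangMillsForm g x Z (fun μ ν => t • X μ ν)
        = t * yangMillsForm g x X Z := by
      intro X Z
      rw [yangMillsForm_comm hs, yangMillsForm_smul_left]
    rw [yangMills_eq, hc]
    simp only [fieldStrength_add_smul (hΓ x (hKU hx)) (hη x)]
    change yangMillsForm g x (fun μ ν => F x μ ν + t • (D x μ ν + t • C x μ ν))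
      (fun μ ν => F x μ ν + t • (D x μ ν + t • C x μ ν)) * w x = _
    simp only [yangMillsForm_add_left, yangMillsForm_smul_left, hr, hr']
    rw [hFF]
    ring
  have hder := hasDerivAt_setIntegral_polynomial hK.measurableSet
    ((hint hDs hFs).const_mul 2) (((hint hCs hFs).const_mul 2).add (hint hDs hDs))
    ((hint hCs hDs).const_mul 2) (hint hCs hCs) hexp
  have hzero : ∫ x in K, 2 * (yangMillsForm g x (D x) (F x) * w x) = 0 := by
    -- off `K` the metric need not be smooth or invertible, but there the variation vanishes
    have hη0 : ∀ x, x ∉ K → ∀ μ, η μ =ᶠ[𝓝 x] fun _ => 0 := by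
      intro x hx μ
      have : ∀ᶠ y in 𝓝 x, y ∉ K := hK.isClosed.isOpen_compl.mem_nhds hx
      filter_upwards [this] with y hy
      ext κ lam
      by_contra hne
      exact hy (hsupp κ μ lam (subset_tsupport _ hne))
    have hV0 : ∀ x, x ∉ K → ∀ μ ν,
        (fun y => (η ν y * fieldDensity g θ μ ν y).trace) =ᶠ[𝓝 x] fun _ => 0 := by
      intro x hx μ ν
      filter_upwards [hη0 x hx ν] with y hy
      rw [hy, zero_mul, Matrix.trace_zero]
    have hV : ∀ μ ν, ContDiff ℝ ∞ fun y => (η ν y * fieldDensity g θ μ ν y).trace := by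
      intro μ ν
      rw [contDiff_iff_contDiffAt]
      intro x
      by_cases hx : x ∈ K
      · exact ContDiffAt.sum fun i _ => (hη x ν).mul
          (fieldDensity_smooth (hg x (hKU hx)) (h0 x (hKU hx)) (hΓ x (hKU hx)) μ ν) i i
      · exact contDiffAt_const.congr_of_eventuallyEq (hV0 x hx μ ν)
    have hVc : ∀ μ ν, HasCompactSupport fun y => (η ν y * fieldDensity g θ μ ν y).trace :=
      fun μ ν => HasCompactSupport.intro hK fun x hx => (hV0 x hx μ ν).eq_of_nhds
    have hi : ∀ μ ν, IntegrableOn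
        (fun x => pd μ (fun y => (η ν y * fieldDensity g θ μ ν y).trace) x) K := by
      intro μ ν
      refine ContinuousOn.integrableOn_compact hK (Continuous.continuousOn ?_)
      exact ((hV μ ν).continuous_fderiv (by simp)).clm_apply continuous_const
    rw [integral_const_mul, setIntegral_congr_fun hK.measurableSet fun x hx =>
      first_variation_eq_divergence (hg x (hKU hx)) (h0 x (hKU hx)) (hΓ x (hKU hx)) (hη x)
        (hYM x (hKU hx)),
      integral_finsetSum _ fun μ _ => integrable_finsetSum _ fun ν _ => (hi μ ν).const_mul 2]
    rw [Finset.sum_eq_zero, mul_zero]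
    intro μ _
    rw [integral_finsetSum _ fun ν _ => (hi μ ν).const_mul 2]
    refine Finset.sum_eq_zero fun ν _ => ?_
    rw [integral_const_mul, setIntegral_eq_integral_of_forall_compl_eq_zero,
      integral_pd_eq_zero (hV μ ν) (hVc μ ν), mul_zero]
    intro x hx
    rw [pd_congr (hV0 x hx μ ν), pd_const]
  rw [hzero] at hder
  exact hder

end FirstVariation

/-! ### Connections of pp-wave type -/

/-- The general element of the matrix Lie algebra that contains the connection forms of pp-waves:
`p` is the coefficient of `∂₀ ⊗ dx³`, `q` and `r` are those of the two null rotations about `∂₀`, and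
`w` is that of the rotation of the `(1,2)`-plane. -/
def nullRot (p q r w : ℝ) : Mat :=
  !![0, q, r, p;
     0, 0, w, q;
     0, -w, 0, r;
     0, 0, 0, 0]

theorem nullRot_commutator (p q r w p' q' r' w' : ℝ) :
    nullRot p q r w * nullRot p' q' r' w' - nullRot p' q' r' w' * nullRot p q r w
      = nullRot 0 (w * r' - w' * r) (w' * q - w * q') 0 := by
  ext i j
  fin_cases i <;> fin_cases j <;> simp [nullRot] <;> ring

/-- The trace form pairs the null rotations and `∂₀ ⊗ dx³` to zero with the whole algebra. -/
theorem nullRot_trace_mul (p q r p' q' r' w' : ℝ) :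
    (nullRot p q r 0 * nullRot p' q' r' w').trace = 0 := by
  simp [nullRot, Matrix.trace, Fin.sum_univ_four]

theorem nullRot_add (p q r w p' q' r' w' : ℝ) :
    nullRot p q r w + nullRot p' q' r' w' = nullRot (p + p') (q + q') (r + r') (w + w') := by
  ext i j
  fin_cases i <;> fin_cases j <;> simp [nullRot]
  ring

theorem nullRot_sub (p q r w p' q' r' w' : ℝ) :
    nullRot p q r w - nullRot p' q' r' w' = nullRot (p - p') (q - q') (r - r') (w - w') := by
  ext i j
  fin_cases i <;> fin_cases j <;> simp [nullRot]
  ring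

theorem nullRot_smul (c p q r w : ℝ) :
    c • nullRot p q r w = nullRot (c * p) (c * q) (c * r) (c * w) := by
  ext i j
  fin_cases i <;> fin_cases j <;> simp [nullRot]

theorem nullRot_zero : nullRot 0 0 0 0 = 0 := by
  ext i j
  fin_cases i <;> fin_cases j <;> simp [nullRot]

theorem mpd_nullRot (μ : Fin 4) (p q r w : R4 → ℝ) (x : R4) :
    mpd μ (fun y => nullRot (p y) (q y) (r y) (w y)) x
      = nullRot (pd μ p x) (pd μ q x) (pd μ r x) (pd μ w x) := by
  ext i j
  fin_cases i <;> fin_cases j <;> simp [nullRot, mpd, pd_const, pd_neg]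

/-- The profile `f` of a pp-metric near `x`, together with the amplitude `a` of the torsion: `f` does
not depend on `x⁰`, and `a` depends on `x³` only. -/
structure IsPPData (F a : R4 → ℝ) (x : R4) : Prop where
  smooth_profile : ∀ᶠ y in 𝓝 x, ContDiffAt ℝ ∞ F y
  smooth_amplitude : ∀ᶠ y in 𝓝 x, ContDiffAt ℝ ∞ a y
  pd_profile : ∀ᶠ y in 𝓝 x, pd 0 F y = 0
  pd_amplitude : ∀ᶠ y in 𝓝 x, ∀ μ, μ ≠ 3 → pd μ a y = 0

/-- The connection form of a metric compatible connection with axial torsion of amplitude `a` over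
the pp-metric with profile `F`. -/
def ppForm (F a : R4 → ℝ) (μ : Fin 4) (x : R4) : Mat :=
  nullRot (1 / 2 * pd μ F x)
    ((![fun _ => 0, fun _ => 0, fun y => -(1 / 2 * a y), fun y => 1 / 2 * pd 1 F y] :
      Fin 4 → R4 → ℝ) μ x)
    ((![fun _ => 0, fun y => 1 / 2 * a y, fun _ => 0, fun y => 1 / 2 * pd 2 F y] :
      Fin 4 → R4 → ℝ) μ x)
    ((![fun _ => 0, fun _ => 0, fun _ => 0, fun y => 1 / 2 * a y] : Fin 4 → R4 → ℝ) μ x)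

/-- The curvature components of `ppForm` with respect to the two null rotations: row `0` belongs to
`R_{31}` and row `1` to `R_{32}`. -/
def ppCoeff (F a : R4 → ℝ) (i j : Fin 2) (x : R4) : ℝ :=
  !![1 / 4 * (a x * a x) - 1 / 2 * pd 1 (pd 1 F) x, 1 / 2 * pd 3 a x - 1 / 2 * pd 1 (pd 2 F) x;
     -(1 / 2) * pd 3 a x - 1 / 2 * pd 1 (pd 2 F) x,
     1 / 4 * (a x * a x) - 1 / 2 * pd 2 (pd 2 F) x] i j

/-- The matrix of a 2-form with `(3,1)` component `b` and `(3,2)` component `c`. -/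
def waveForm (b c : ℝ) : Mat :=
  !![0, 0, 0, 0;
     0, 0, 0, -b;
     0, 0, 0, -c;
     0, b, c, 0]

section PPForm

variable {F a : R4 → ℝ} {x : R4}

theorem IsPPData.eventually (h : IsPPData F a x) : ∀ᶠ y in 𝓝 x, IsPPData F a y := by
  filter_upwards [h.smooth_profile.eventually_nhds, h.smooth_amplitude.eventually_nhds,
    h.pd_profile.eventually_nhds, h.pd_amplitude.eventually_nhds] with y h1 h2 h3 h4
  exact ⟨h1, h2, h3, h4⟩

/-- The curvature of a pp-wave connection consists of null rotations, and only its components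
`R_{31}` and `R_{32}` (and `R_{13}`, `R_{23}`) are nonzero. -/
theorem fieldStrength_ppForm (h : IsPPData F a x) (μ ν : Fin 4) :
    fieldStrength (ppForm F a) μ ν x
      = nullRot 0 (waveForm (ppCoeff F a 0 0 x) (ppCoeff F a 1 0 x) μ ν)
          (waveForm (ppCoeff F a 0 1 x) (ppCoeff F a 1 1 x) μ ν) 0 := by
  have hF := h.smooth_profile.self_of_nhds
  have ha := h.smooth_amplitude.self_of_nhds
  have h0 := h.pd_profile.self_of_nhds
  have ha' := h.pd_amplitude.self_of_nhds
  have e0 : pd 0 F =ᶠ[𝓝 x] fun _ => 0 := h.pd_profile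
  have e : ∀ ν, pd ν (pd 0 F) x = 0 := fun ν => by rw [pd_congr e0, pd_const]
  have e' : ∀ ν, pd 0 (pd ν F) x = 0 := fun ν => by rw [pd_comm hF, e]
  have a0 := ha' 0 (by decide)
  have a1 := ha' 1 (by decide)
  have a2 := ha' 2 (by decide)
  have h21 : pd 2 (pd 1 F) x = pd 1 (pd 2 F) x := pd_comm hF
  have h31 : pd 3 (pd 1 F) x = pd 1 (pd 3 F) x := pd_comm hF
  have h32 : pd 3 (pd 2 F) x = pd 2 (pd 3 F) x := pd_comm hF
  unfold fieldStrength
  unfold ppForm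
  rw [mpd_nullRot, mpd_nullRot, nullRot_commutator, nullRot_sub, nullRot_add]
  fin_cases μ <;> fin_cases ν <;>
    simp [waveForm, ppCoeff, pd_const, pd_const_mul, pd_neg, e, e', a0, a1, a2, h21, h31, h32] <;>
    congr 1 <;> ring

end PPForm

/-! ### The Yang-Mills equation for pp-waves -/

/-- The pp-metric at a point where the profile has the value `F`. -/
def ppMatrix (F : ℝ) : Mat :=
  !![0, 0, 0, 1;
     0, -1, 0, 0;
     0, 0, -1, 0;
     1, 0, 0, F]

theorem ppMatrix_inv (F : ℝ) : (ppMatrix F)⁻¹ =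
    !![-F, 0, 0, 1;
       0, -1, 0, 0;
       0, 0, -1, 0;
       1, 0, 0, 0] := by
  refine Matrix.inv_eq_right_inv ?_
  ext i j
  fin_cases i <;> fin_cases j <;> simp [ppMatrix]

theorem ppMatrix_det (F : ℝ) : (ppMatrix F).det = -1 := by
  simp [ppMatrix, Matrix.det_succ_row_zero, Fin.sum_univ_succ, Fin.succAbove]
  norm_num

section PPField

variable {F a : R4 → ℝ} {g : TwoTensor} {x : R4}

/-- The only nonzero components of the field density are `P^{01} = -R_{31}`, `P^{02} = -R_{32}` and
those obtained from them by antisymmetry. -/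
theorem fieldDensity_ppForm (h : IsPPData F a x) (hg : g x = ppMatrix (F x)) (μ ν : Fin 4) :
    fieldDensity g (ppForm F a) μ ν x
      = nullRot 0
        ((!![0, -ppCoeff F a 0 0 x, -ppCoeff F a 1 0 x, 0;
           ppCoeff F a 0 0 x, 0, 0, 0; ppCoeff F a 1 0 x, 0, 0, 0; 0, 0, 0, 0] : Mat) μ ν)
        ((!![0, -ppCoeff F a 0 1 x, -ppCoeff F a 1 1 x, 0;
           ppCoeff F a 0 1 x, 0, 0, 0; ppCoeff F a 1 1 x, 0, 0, 0; 0, 0, 0, 0] : Mat) μ ν) 0 := by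
  unfold fieldDensity
  simp only [fieldStrength_ppForm h, nullRot_smul, hg, ppMatrix_inv, Fin.sum_univ_four,
    nullRot_add, ppMatrix_det]
  fin_cases μ <;> fin_cases ν <;> simp [waveForm]

/-- The Yang-Mills equation for pp-waves. The only component of the divergence that is not zero
outright has as its coefficients the first two derivatives of the transverse Laplacian, up to a
factor; the torsion drops out of it because the amplitude depends on `x³` only. -/
theorem gaugeDiv_ppForm (h : IsPPData F a x) (hg : ∀ᶠ y in 𝓝 x, g y = ppMatrix (F y))
    (hlap : ∀ μ, pd μ (fun y => pd 1 (pd 1 F) y + pd 2 (pd 2 F) y) x = 0) (ν : Fin 4) :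
    gaugeDiv (ppForm F a) (fieldDensity g (ppForm F a)) ν x = 0 := by
  have hF := h.smooth_profile.self_of_nhds
  have ha := h.smooth_amplitude.self_of_nhds
  have e0 : pd 0 F =ᶠ[𝓝 x] fun _ => 0 := h.pd_profile
  have e3 : ∀ μ ν, pd 0 (pd μ (pd ν F)) x = 0 := by
    intro μ ν
    rw [pd_comm (pd_smooth hF)]
    have : pd 0 (pd ν F) =ᶠ[𝓝 x] fun _ => 0 := by
      filter_upwards [h.smooth_profile, e0.eventuallyEq_nhds] with y hy hy0
      rw [pd_comm hy, pd_congr hy0, pd_const]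
    rw [pd_congr this, pd_const]
  have ha' := h.pd_amplitude.self_of_nhds
  have a3 : ∀ μ, μ ≠ 3 → pd μ (pd 3 a) x = 0 := by
    intro μ hμ
    rw [pd_comm ha]
    have : pd μ a =ᶠ[𝓝 x] fun _ => 0 := h.pd_amplitude.mono fun y hy => hy μ hμ
    rw [pd_congr this, pd_const]
  have h12 : pd 1 (pd 2 F) =ᶠ[𝓝 x] pd 2 (pd 1 F) := by
    filter_upwards [h.smooth_profile] with y hy using pd_comm hy
  have hc : ∀ μ ν, DifferentiableAt ℝ (pd μ (pd ν F)) x := fun μ ν =>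
    smooth_differentiableAt (pd_smooth (pd_smooth hF))
  have hda := smooth_differentiableAt ha
  have hd3 : DifferentiableAt ℝ (pd 3 a) x := smooth_differentiableAt (pd_smooth ha)
  have hlap' : ∀ μ, pd μ (pd 1 (pd 1 F)) x + pd μ (pd 2 (pd 2 F)) x = 0 := by
    intro μ
    rw [← hlap μ, pd_add (hc 1 1) (hc 2 2)]
  -- derivatives of the four curvature coefficients
  have d00 : ∀ μ, pd μ (ppCoeff F a 0 0) x
      = 1 / 2 * (a x * pd μ a x) - 1 / 2 * pd μ (pd 1 (pd 1 F)) x := by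
    intro μ
    change pd μ (fun y => 1 / 4 * (a y * a y) - 1 / 2 * pd 1 (pd 1 F) y) x = _
    rw [pd_sub ((hda.fun_mul hda).const_mul _) ((hc 1 1).const_mul _), pd_const_mul, pd_const_mul,
      pd_mul hda hda]
    ring
  have d11 : ∀ μ, pd μ (ppCoeff F a 1 1) x
      = 1 / 2 * (a x * pd μ a x) - 1 / 2 * pd μ (pd 2 (pd 2 F)) x := by
    intro μ
    change pd μ (fun y => 1 / 4 * (a y * a y) - 1 / 2 * pd 2 (pd 2 F) y) x = _
    rw [pd_sub ((hda.fun_mul hda).const_mul _) ((hc 2 2).const_mul _), pd_const_mul, pd_const_mul,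
      pd_mul hda hda]
    ring
  have d01 : ∀ μ, pd μ (ppCoeff F a 0 1) x
      = 1 / 2 * pd μ (pd 3 a) x - 1 / 2 * pd μ (pd 1 (pd 2 F)) x := by
    intro μ
    change pd μ (fun y => 1 / 2 * pd 3 a y - 1 / 2 * pd 1 (pd 2 F) y) x = _
    rw [pd_sub (hd3.const_mul _) ((hc 1 2).const_mul _), pd_const_mul, pd_const_mul]
  have d10 : ∀ μ, pd μ (ppCoeff F a 1 0) x
      = -(1 / 2) * pd μ (pd 3 a) x - 1 / 2 * pd μ (pd 1 (pd 2 F)) x := by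
    intro μ
    change pd μ (fun y => -(1 / 2) * pd 3 a y - 1 / 2 * pd 1 (pd 2 F) y) x = _
    rw [pd_sub (hd3.const_mul _) ((hc 1 2).const_mul _), pd_const_mul, pd_const_mul]
  have a0 := ha' 0 (by decide)
  have a1 := ha' 1 (by decide)
  have a2 := ha' 2 (by decide)
  have a30 := a3 0 (by decide)
  have a31 := a3 1 (by decide)
  have a32 := a3 2 (by decide)
  have c1 : pd 2 (pd 1 (pd 2 F)) x = pd 1 (pd 2 (pd 2 F)) x := pd_comm (pd_smooth hF)
  have c2 : pd 1 (pd 1 (pd 2 F)) x = pd 2 (pd 1 (pd 1 F)) x := by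
    have h1 : pd 1 (pd 1 (pd 2 F)) x = pd 1 (pd 2 (pd 1 F)) x := pd_congr h12
    rw [h1, pd_comm (pd_smooth hF)]
  have hP : ∀ μ, mpd μ (fieldDensity g (ppForm F a) μ ν) x
      = nullRot 0
        (pd μ (fun y => (!![0, -ppCoeff F a 0 0 y, -ppCoeff F a 1 0 y, 0;
           ppCoeff F a 0 0 y, 0, 0, 0; ppCoeff F a 1 0 y, 0, 0, 0; 0, 0, 0, 0] : Mat) μ ν) x)
        (pd μ (fun y => (!![0, -ppCoeff F a 0 1 y, -ppCoeff F a 1 1 y, 0;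
           ppCoeff F a 0 1 y, 0, 0, 0; ppCoeff F a 1 1 y, 0, 0, 0; 0, 0, 0, 0] : Mat) μ ν) x)
        0 := by
    intro μ
    have := (h.eventually.and hg).mono fun y hy => fieldDensity_ppForm hy.1 hy.2 μ ν
    rw [mpd_congr this, mpd_nullRot, pd_const]
  unfold gaugeDiv
  simp only [hP, fieldDensity_ppForm h hg.self_of_nhds, ppForm, nullRot_commutator, nullRot_add,
    Fin.sum_univ_four]
  rw [← nullRot_zero]
  have l1 := hlap' 1
  have l2 := hlap' 2
  fin_cases ν <;>
    simp [pd_const, pd_neg, d00, d01, d10, d11, a0, a1, a2, a30, a31, a32, e3, c1, c2]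
  congr 1 <;> linarith

end PPField

/-! ### Metric compatible connections with axial torsion -/

/-- The values of the Levi-Civita symbol `ε_{0κμν}`. -/
theorem eps_zero (κ μ ν : Fin 4) : eps 0 κ μ ν =
    (![0, !![0, 0, 0, 0; 0, 0, 0, 0; 0, 0, 0, 1; 0, 0, -1, 0],
       !![0, 0, 0, 0; 0, 0, 0, -1; 0, 0, 0, 0; 0, 1, 0, 0],
       !![0, 0, 0, 0; 0, 0, 1, 0; 0, -1, 0, 0; 0, 0, 0, 0]] : Fin 4 → Mat) κ μ ν := by
  have h : eps 0 κ μ ν = Matrix.det (Matrix.of fun i j : Fin 3 =>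
      if (![κ, μ, ν] : Fin 3 → Fin 4) i = j.succ then (1 : ℝ) else 0) := by
    rw [eps, Matrix.det_succ_row_zero, Fin.sum_univ_succ, Finset.sum_eq_zero]
    · simp only [Matrix.of_apply, Matrix.cons_val_zero, if_true, Fin.val_zero, pow_zero, one_mul,
        add_zero]
      rfl
    · intro i _
      simp [(Fin.succ_ne_zero i).symm]
  rw [h, Matrix.det_fin_three]
  fin_cases κ <;> fin_cases μ <;> fin_cases ν <;> simp [Fin.ext_iff]

theorem eps_zero_swap (κ μ ν : Fin 4) : eps 0 κ ν μ = -eps 0 κ μ ν := by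
  rw [eps_zero, eps_zero]
  fin_cases κ <;> fin_cases μ <;> fin_cases ν <;> simp

theorem eps_zero_cycle (κ μ ν : Fin 4) : eps 0 μ ν κ = eps 0 κ μ ν := by
  rw [eps_zero, eps_zero]
  fin_cases κ <;> fin_cases μ <;> fin_cases ν <;> simp

/-- A metric compatible connection with totally antisymmetric torsion `T` is the sum of the
Levi-Civita connection and `T / 2`. -/
theorem eq_leviCivita_add_half_torsion {g : TwoTensor} {Γ : Coeffs} {x : R4}
    {T : Fin 4 → Fin 4 → Fin 4 → ℝ} (hsymm : (g x).IsSymm) (h0 : (g x).det ≠ 0)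
    (hcompat : ∀ ρ μ ν, covDeriv₂ Γ g x ρ μ ν = 0)
    (htor : ∀ κ μ ν, torsionLow g Γ x κ μ ν = T κ μ ν)
    (hswap : ∀ κ μ ν, T κ ν μ = -T κ μ ν) (hcycle : ∀ κ μ ν, T μ ν κ = T κ μ ν)
    (lam μ ν : Fin 4) :
    Γ x lam μ ν = leviCivita g x lam μ ν + 1 / 2 * ∑ κ, (g x)⁻¹ lam κ * T κ μ ν := by
  have hs : ∀ i j, g x i j = g x j i := fun i j => hsymm.apply j i
  set G : Fin 4 → Fin 4 → Fin 4 → ℝ := fun κ μ ν => ∑ η, g x κ η * Γ x η μ ν with hG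
  have hc : ∀ ρ μ ν, pd ρ (fun y => g y μ ν) x = G ν ρ μ + G μ ρ ν := by
    intro ρ μ ν
    have h : pd ρ (fun y => g y μ ν) x
        - ∑ η, (Γ x η ρ μ * g x η ν + Γ x η ρ ν * g x μ η) = 0 := hcompat ρ μ ν
    rw [sub_eq_zero] at h
    rw [h, hG, ← Finset.sum_add_distrib]
    refine Finset.sum_congr rfl fun η _ => ?_
    rw [hs η ν]
    ring
  have ht : ∀ κ μ ν, G κ μ ν - G κ ν μ = T κ μ ν := by
    intro κ μ ν
    rw [← htor, torsionLow, hG, ← Finset.sum_sub_distrib]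
    refine Finset.sum_congr rfl fun η _ => ?_
    rw [torsion]
    ring
  have hlow : ∀ κ, pd μ (fun y => g y κ ν) x + pd ν (fun y => g y κ μ) x
      - pd κ (fun y => g y μ ν) x = 2 * G κ μ ν - T κ μ ν := by
    intro κ
    rw [hc, hc, hc]
    have h1 := ht κ μ ν
    have h2 := ht ν μ κ
    have h3 := ht μ ν κ
    have h4 := hswap ν κ μ
    have h5 := hcycle κ μ ν
    have h6 := hcycle μ ν κ
    linarith
  have hraise : ∑ κ, (g x)⁻¹ lam κ * G κ μ ν = Γ x lam μ ν := by
    have h1 : (g x)⁻¹ * (g x * Matrix.of fun η (_ : Fin 1) => Γ x η μ ν)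
        = Matrix.of fun η (_ : Fin 1) => Γ x η μ ν := by
      rw [← Matrix.mul_assoc, Matrix.nonsing_inv_mul _ (isUnit_iff_ne_zero.2 h0), Matrix.one_mul]
    have h2 := congrFun (congrFun h1 lam) 0
    simpa only [Matrix.mul_apply, Matrix.of_apply] using h2
  unfold leviCivita
  simp only [hlow]
  rw [← mul_add, ← Finset.sum_add_distrib, ← hraise, Finset.mul_sum]
  refine Finset.sum_congr rfl fun κ _ => ?_
  ring

section PPConnection

variable {F a : R4 → ℝ} {g : TwoTensor} {Γ : Coeffs} {x : R4}

theorem conn_leviCivita_pp (hg : ∀ᶠ y in 𝓝 x, g y = ppMatrix (F y)) (h0 : pd 0 F x = 0)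
    (μ : Fin 4) : conn (leviCivita g) μ x = ppForm F (fun _ => 0) μ x := by
  have hd : ∀ ρ κ ν, pd ρ (fun y => g y κ ν) x = if κ = 3 ∧ ν = 3 then pd ρ F x else 0 := by
    intro ρ κ ν
    rw [pd_congr (G := fun y => ppMatrix (F y) κ ν) (hg.mono fun y hy => by rw [hy])]
    fin_cases κ <;> fin_cases ν <;> simp [ppMatrix, pd_const]
  ext κ lam
  simp only [conn, leviCivita, hd, hg.self_of_nhds, ppMatrix_inv, Matrix.of_apply,
    Fin.sum_univ_four]
  fin_cases μ <;> fin_cases κ <;> fin_cases lam <;> simp [ppForm, nullRot, h0]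

theorem conn_eq_ppForm (hg : ∀ᶠ y in 𝓝 x, g y = ppMatrix (F y)) (h0 : pd 0 F x = 0)
    (hcompat : ∀ ρ μ ν, covDeriv₂ Γ g x ρ μ ν = 0)
    (htor : ∀ κ μ ν, torsionLow g Γ x κ μ ν = a x * eps 0 κ μ ν) (μ : Fin 4) :
    conn Γ μ x = ppForm F a μ x := by
  have hgx := hg.self_of_nhds
  have hsymm : (g x).IsSymm := by
    rw [hgx]
    ext i j
    fin_cases i <;> fin_cases j <;> simp [ppMatrix]
  have hdet : (g x).det ≠ 0 := by rw [hgx, ppMatrix_det]; norm_num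
  ext κ lam
  have h1 : conn Γ μ x κ lam = _ := eq_leviCivita_add_half_torsion hsymm hdet hcompat htor
    (fun κ μ ν => by rw [eps_zero_swap, mul_neg]) (fun κ μ ν => by rw [eps_zero_cycle]) κ μ lam
  have h2 : leviCivita g x κ μ lam = ppForm F (fun _ => 0) μ x κ lam := by
    rw [← conn_leviCivita_pp hg h0]
    rfl
  rw [h1, h2, hgx, ppMatrix_inv]
  simp only [Fin.sum_univ_four, eps_zero]
  fin_cases μ <;> fin_cases κ <;> fin_cases lam <;> simp [ppForm, nullRot]

end PPConnection

/-! ### Dependence on germs -/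

section Congruence

variable {θ θ' : Fin 4 → R4 → Mat} {P P' : Fin 4 → Fin 4 → R4 → Mat} {x : R4}

theorem fieldStrength_congr (h : ∀ μ, θ μ =ᶠ[𝓝 x] θ' μ) (μ ν : Fin 4) :
    fieldStrength θ μ ν x = fieldStrength θ' μ ν x := by
  unfold fieldStrength
  rw [mpd_congr (h ν), mpd_congr (h μ), (h μ).eq_of_nhds, (h ν).eq_of_nhds]

theorem gaugeDiv_congr (h : ∀ μ, θ μ =ᶠ[𝓝 x] θ' μ) (hP : ∀ μ ν, P μ ν =ᶠ[𝓝 x] P' μ ν)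
    (ν : Fin 4) : gaugeDiv θ P ν x = gaugeDiv θ' P' ν x := by
  unfold gaugeDiv
  refine Finset.sum_congr rfl fun μ _ => ?_
  rw [mpd_congr (hP μ ν), (h μ).eq_of_nhds, (hP μ ν).eq_of_nhds]

theorem fieldDensity_congr {g : TwoTensor} (h : ∀ μ, θ μ =ᶠ[𝓝 x] θ' μ) (μ ν : Fin 4) :
    fieldDensity g θ μ ν =ᶠ[𝓝 x] fieldDensity g θ' μ ν := by
  have h' : ∀ᶠ y in 𝓝 x, ∀ μ, θ μ =ᶠ[𝓝 y] θ' μ :=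
    eventually_all.2 fun μ => (h μ).eventuallyEq_nhds
  filter_upwards [h'] with y hy
  unfold fieldDensity
  simp only [fieldStrength_congr hy]

end Congruence

/-! ### The Ricci curvature of a pp-metric -/

section Ricci

variable {F : R4 → ℝ} {g : TwoTensor} {x : R4}

theorem ricci_leviCivita_pp (h : IsPPData F (fun _ => 0) x)
    (hg : ∀ᶠ y in 𝓝 x, g y = ppMatrix (F y)) (lam ν : Fin 4) :
    ricci (leviCivita g) x lam ν =
      if lam = 3 ∧ ν = 3 then 1 / 2 * (pd 1 (pd 1 F) x + pd 2 (pd 2 F) x) else 0 := by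
  have hc : ∀ μ, conn (leviCivita g) μ =ᶠ[𝓝 x] ppForm F (fun _ => 0) μ := by
    intro μ
    filter_upwards [hg.eventually_nhds, h.pd_profile] with y hy hy0 using conn_leviCivita_pp hy hy0 μ
  unfold ricci
  simp only [curvature_eq_fieldStrength, fieldStrength_congr hc, fieldStrength_ppForm h,
    Fin.sum_univ_four]
  fin_cases lam <;> fin_cases ν <;> simp [nullRot, waveForm, ppCoeff]
  ring

theorem covDeriv_ricci_leviCivita_pp (h : IsPPData F (fun _ => 0) x)
    (hg : ∀ᶠ y in 𝓝 x, g y = ppMatrix (F y)) (ρ μ ν : Fin 4) :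
    covDeriv₂ (leviCivita g) (ricci (leviCivita g)) x ρ μ ν =
      if μ = 3 ∧ ν = 3 then 1 / 2 * pd ρ (fun y => pd 1 (pd 1 F) y + pd 2 (pd 2 F) y) x else 0 := by
  have hr : ∀ᶠ y in 𝓝 x, ∀ lam ν, ricci (leviCivita g) y lam ν =
      if lam = 3 ∧ ν = 3 then 1 / 2 * (pd 1 (pd 1 F) y + pd 2 (pd 2 F) y) else 0 := by
    filter_upwards [h.eventually, hg.eventually_nhds] with y hy hgy using ricci_leviCivita_pp hy hgy
  have hΓ : ∀ μ ν, leviCivita g x 3 μ ν = 0 := by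
    intro μ ν
    have h1 : leviCivita g x 3 μ ν = conn (leviCivita g) μ x 3 ν := rfl
    rw [h1, conn_leviCivita_pp hg h.pd_profile.self_of_nhds]
    fin_cases ν <;> simp [ppForm, nullRot]
  unfold covDeriv₂
  rw [pd_congr (hr.mono fun y hy => hy μ ν)]
  simp only [hr.self_of_nhds]
  rw [Finset.sum_eq_zero, sub_zero]
  · split_ifs
    · rw [pd_const_mul]
    · rw [pd_const]
  · intro η _
    by_cases hη : η = 3
    · simp [hη, hΓ]
    · simp [hη]

end Ricci

/-- A smooth function on an open set is locally constant if and only if its gradient vanishes. -/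
theorem locally_constant_iff_pd_eq_zero {U : Set R4} (hU : IsOpen U) {L : R4 → ℝ}
    (hL : ∀ x ∈ U, ContDiffAt ℝ ∞ L x) :
    (∀ x ∈ U, ∀ ρ, pd ρ L x = 0) ↔ ∀ x ∈ U, ∃ C : ℝ, ∀ᶠ y in 𝓝 x, L y = C := by
  constructor
  · intro h x hx
    obtain ⟨ε, hε, hball⟩ := Metric.isOpen_iff.1 hU x hx
    obtain ⟨C, hC⟩ := Metric.isOpen_ball.exists_is_const_of_fderiv_eq_zero (𝕜 := ℝ) (f := L)
      (convex_ball x ε).isPreconnected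
      (fun y hy => (smooth_differentiableAt (hL y (hball hy))).differentiableWithinAt)
      (fun y hy => by
        ext v
        rw [fderiv_eq_sum_pd]
        simp [h y (hball hy)])
    exact ⟨C, by filter_upwards [Metric.ball_mem_nhds x hε] with y hy using hC y hy⟩
  · intro h x hx ρ
    obtain ⟨C, hC⟩ := h x hx
    rw [pd_congr hC, pd_const]

/-! ### Invariance under changes of charts -/

section Charts

variable {M : Type*} [TopologicalSpace M] [ChartedSpace R4 M]

theorem Chart.isOpen_range (e : Chart M) : IsOpen e.range := e.1.open_target

theorem Chart.isOpen_overlap (e e' : Chart M) : IsOpen (e.overlap e') :=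
  e.1.isOpen_inter_preimage_symm e'.1.open_source

theorem Chart.change_mem_range {e e' : Chart M} {x : R4} (hx : x ∈ e.overlap e') :
    e.change e' x ∈ e'.range := e'.1.map_source hx.2

theorem Chart.change_smooth [IsManifold 𝓘(ℝ, R4) ∞ M] {e e' : Chart M} {x : R4}
    (hx : x ∈ e.overlap e') (α : Fin 4) : ContDiffAt ℝ ∞ (fun y => e.change e' y α) x := by
  have h1 := (contMDiffOn_symm_of_mem_maximalAtlas (I := 𝓘(ℝ, R4)) (n := ∞) e.2).contMDiffAt
    (e.1.open_target.mem_nhds hx.1)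
  have h2 := (contMDiffOn_of_mem_maximalAtlas (I := 𝓘(ℝ, R4)) (n := ∞) e'.2).contMDiffAt
    (e'.1.open_source.mem_nhds hx.2)
  have h3 : ContMDiffAt 𝓘(ℝ, R4) 𝓘(ℝ, R4) ∞ (fun y => e.change e' y) x := h2.comp x h1
  exact contDiffAt_pi.1 h3.contDiffAt α

theorem Chart.jac_eq_jacobian (e e' : Chart M) (x : R4) :
    e.jac e' x = jacobian (e.change e') x := rfl

namespace Spacetime

variable (S : Spacetime M) {e e' : Chart M} {x : R4}

theorem g_smoothAt (hx : x ∈ e.range) : MSmoothAt (S.g e) x :=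
  fun μ ν => (S.g_smooth e μ ν).contDiffAt (e.isOpen_range.mem_nhds hx)

theorem conn_smoothAt (hx : x ∈ e.range) (μ : Fin 4) : MSmoothAt (conn (S.Γ e) μ) x :=
  fun κ lam => (S.Γ_smooth e κ μ lam).contDiffAt (e.isOpen_range.mem_nhds hx)

theorem g_det_ne_zero (hx : x ∈ e.range) : (S.g e x).det ≠ 0 := by
  obtain ⟨P, _, hP⟩ := S.g_lorentz e x hx
  intro h
  have h1 := congrArg Matrix.det hP
  rw [Matrix.det_mul, Matrix.det_mul, h, Matrix.det_diagonal] at h1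
  simp [Fin.prod_univ_four] at h1

theorem g_change_matrix (hx : x ∈ e.overlap e') :
    S.g e x = (jacobian (e.change e') x).transpose * S.g e' (e.change e' x)
      * jacobian (e.change e') x := by
  ext μ ν
  rw [S.g_change e e' x hx μ ν]
  simp only [Matrix.mul_apply, Matrix.transpose_apply, Finset.sum_mul]
  rw [Finset.sum_comm]
  simp only [Chart.jac_eq_jacobian]
  refine Finset.sum_congr rfl fun α _ => Finset.sum_congr rfl fun β _ => ?_
  ring

/-- A Jacobian is invertible because it relates two nondegenerate metrics. -/
theorem jacobian_det_ne_zero (S : Spacetime M) (hx : x ∈ e.overlap e') :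
    (jacobian (e.change e') x).det ≠ 0 := by
  intro h
  have h1 := congrArg Matrix.det (S.g_change_matrix hx)
  rw [Matrix.det_mul, h, mul_zero] at h1
  exact S.g_det_ne_zero hx.1 h1

theorem conn_change (hx : x ∈ e.overlap e') (μ : Fin 4) :
    jacobian (e.change e') x * conn (S.Γ e) μ x
      = pullback (e.change e') (conn (S.Γ e')) μ x * jacobian (e.change e') x
        + mpd μ (jacobian (e.change e')) x := by
  ext α ν
  have h := S.Γ_change e e' x hx α μ ν
  simp only [Chart.jac_eq_jacobian] at h
  simp only [Matrix.mul_apply, Matrix.add_apply, conn, Matrix.of_apply, pullback, Matrix.sum_apply,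
    Matrix.smul_apply, smul_eq_mul]
  refine h.trans ?_
  congr 1
  rw [Finset.sum_comm]
  refine Finset.sum_congr rfl fun γ _ => ?_
  rw [Finset.sum_mul]
  refine Finset.sum_congr rfl fun β _ => ?_
  ring

theorem conn_change_eventually (hx : x ∈ e.overlap e') : ∀ᶠ y in 𝓝 x, ∀ μ,
    jacobian (e.change e') y * conn (S.Γ e) μ y
      = pullback (e.change e') (conn (S.Γ e')) μ y * jacobian (e.change e') y
        + mpd μ (jacobian (e.change e')) y := by
  filter_upwards [(e.isOpen_overlap e').mem_nhds hx] with y hy using S.conn_change hy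

variable [IsManifold 𝓘(ℝ, R4) ∞ M]

/-- The curvature is a tensor. -/
theorem fieldStrength_change (hx : x ∈ e.overlap e') (μ ν : Fin 4) :
    jacobian (e.change e') x * fieldStrength (conn (S.Γ e)) μ ν x
      = (∑ α, ∑ β, (jacobian (e.change e') x α μ * jacobian (e.change e') x β ν) •
        fieldStrength (conn (S.Γ e')) α β (e.change e' x)) * jacobian (e.change e') x := by
  have hΦ := Chart.change_smooth hx
  have hθ' := fun μ => S.conn_smoothAt (Chart.change_mem_range hx) μ
  rw [← fieldStrength_pullback hΦ hθ']
  exact fieldStrength_gauge (jacobian_smooth hΦ) (S.conn_smoothAt hx.1) (pullback_smooth hΦ hθ')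
    (S.conn_change_eventually hx) μ ν

/-- The vanishing of all traces `tr (R_{μν} R_{αβ})` does not depend on the coordinates. -/
theorem trace_eq_zero_of_change (hx : x ∈ e.overlap e')
    (h : ∀ μ ν α β, (fieldStrength (conn (S.Γ e')) μ ν (e.change e' x)
      * fieldStrength (conn (S.Γ e')) α β (e.change e' x)).trace = 0) (μ ν α β : Fin 4) :
    (fieldStrength (conn (S.Γ e)) μ ν x * fieldStrength (conn (S.Γ e)) α β x).trace = 0 := by
  set J := jacobian (e.change e') x with hJ
  have hu : IsUnit J.det := isUnit_iff_ne_zero.2 (S.jacobian_det_ne_zero hx)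
  have h1 : J * (fieldStrength (conn (S.Γ e)) μ ν x * fieldStrength (conn (S.Γ e)) α β x) * J⁻¹
      = (∑ γ, ∑ δ, (J γ μ * J δ ν) • fieldStrength (conn (S.Γ e')) γ δ (e.change e' x))
        * ∑ γ, ∑ δ, (J γ α * J δ β) • fieldStrength (conn (S.Γ e')) γ δ (e.change e' x) := by
    rw [← mul_assoc, S.fieldStrength_change hx, mul_assoc _ J, S.fieldStrength_change hx,
      mul_assoc, mul_assoc, Matrix.mul_nonsing_inv _ hu, mul_one]
  have h2 : (J * (fieldStrength (conn (S.Γ e)) μ ν x * fieldStrength (conn (S.Γ e)) α β x)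
      * J⁻¹).trace = 0 := by
    rw [h1]
    simp only [Finset.sum_mul, Finset.mul_sum, Matrix.trace_sum, Matrix.smul_mul, Matrix.mul_smul,
      Matrix.trace_smul, h, smul_zero, Finset.sum_const_zero]
  rwa [Matrix.trace_mul_comm, ← mul_assoc, Matrix.nonsing_inv_mul _ hu, one_mul] at h2

/-- The Yang-Mills equation does not depend on the coordinates. -/
theorem gaugeDiv_eq_zero_of_change (hx : x ∈ e.overlap e')
    (h : ∀ ν, gaugeDiv (conn (S.Γ e')) (fieldDensity (S.g e') (conn (S.Γ e'))) ν
      (e.change e' x) = 0) (ν : Fin 4) :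
    gaugeDiv (conn (S.Γ e)) (fieldDensity (S.g e) (conn (S.Γ e))) ν x = 0 := by
  have hΦ := Chart.change_smooth hx
  have h0 := S.jacobian_det_ne_zero hx
  have hx' := Chart.change_mem_range hx
  have hP' := fieldDensity_smooth (S.g_smoothAt hx') (S.g_det_ne_zero hx')
    (S.conn_smoothAt hx')
  have hPQ : ∀ᶠ y in 𝓝 x, ∀ μ ν,
      jacobian (e.change e') y * fieldDensity (S.g e) (conn (S.Γ e)) μ ν y
        = pullbackDensity (e.change e') (fieldDensity (S.g e') (conn (S.Γ e'))) μ ν y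
          * jacobian (e.change e') y := by
    filter_upwards [(e.isOpen_overlap e').mem_nhds hx] with y hy using
      fieldDensity_change (S.jacobian_det_ne_zero hy) (S.g_change_matrix hy)
        (S.fieldStrength_change hy)
  have h1 := gaugeDiv_gauge (jacobian_smooth hΦ)
    (fieldDensity_smooth (S.g_smoothAt hx.1) (S.g_det_ne_zero hx.1) (S.conn_smoothAt hx.1))
    (pullbackDensity_smooth h0 hΦ hP') (S.conn_change_eventually hx) hPQ ν
  rw [gaugeDiv_pullback h0 hΦ hP' fun α β => fieldDensity_antisymm α β] at h1
  simp only [h, smul_zero, Finset.sum_const_zero, zero_mul] at h1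
  have h2 := congrArg ((jacobian (e.change e') x)⁻¹ * ·) h1
  simpa only [← mul_assoc, Matrix.nonsing_inv_mul _ (isUnit_iff_ne_zero.2 h0), one_mul,
    mul_zero] using h2

end Spacetime

end Charts

/-! ### Generalised pp-waves -/

/-- A partial derivative vanishes if the function is constant near the point along the coordinate
line. -/
theorem pd_eq_zero_of_line {F : R4 → ℝ} {x : R4} {μ : Fin 4} (hF : DifferentiableAt ℝ F x)
    (h : ∀ᶠ t in 𝓝 (0 : ℝ), F (x + t • Pi.single μ 1) = F x) : pd μ F x = 0 := by
  have h1 : (fun t : ℝ => F (x + t • Pi.single μ 1)) =ᶠ[𝓝 0] fun _ => F x := h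
  rw [pd, ← hF.lineDeriv_eq_fderiv, lineDeriv, h1.deriv_eq, deriv_const]

theorem eventually_const_on_line {U : Set R4} (hU : IsOpen U) {H : R4 → ℝ} {x : R4} (hx : x ∈ U)
    {μ : Fin 4} (hH : ∀ y ∈ U, DifferentiableAt ℝ H y) (h0 : ∀ y ∈ U, pd μ H y = 0) :
    ∀ᶠ t in 𝓝 (0 : ℝ), H (x + t • Pi.single μ 1) = H x := by
  have hline : ∀ t : ℝ, HasDerivAt (fun t : ℝ => x + t • (Pi.single μ 1 : R4)) (Pi.single μ 1) t := by
    intro t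
    simpa using ((hasDerivAt_id t).smul_const (Pi.single μ 1 : R4)).const_add x
  have hmem : ∀ᶠ t in 𝓝 (0 : ℝ), x + t • (Pi.single μ 1 : R4) ∈ U :=
    (hline 0).continuousAt.eventually_mem (hU.mem_nhds (by simpa using hx))
  obtain ⟨ε, hε, hball⟩ := Metric.eventually_nhds_iff_ball.1 hmem
  have hd : ∀ t ∈ Metric.ball (0 : ℝ) ε,
      HasDerivAt (fun t : ℝ => H (x + t • (Pi.single μ 1 : R4))) 0 t := by
    intro t ht
    have := (hH _ (hball t ht)).hasFDerivAt.comp_hasDerivAt t (hline t)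
    exact this.congr_deriv (h0 _ (hball t ht))
  filter_upwards [Metric.ball_mem_nhds (0 : ℝ) hε] with t ht
  have := Metric.isOpen_ball.is_const_of_deriv_eq_zero (convex_ball (0 : ℝ) ε).isPreconnected
    (fun t ht => (hd t ht).differentiableAt.differentiableWithinAt)
    (fun t ht => (hd t ht).deriv) ht (Metric.mem_ball_self hε)
  simpa using this

/-- The profile of a pp-metric as a function of the coordinates. -/
def profile (f : ℝ → ℝ → ℝ → ℝ) (x : R4) : ℝ := f (x 1) (x 2) (x 3)

section PPCharts

variable {M : Type*} [TopologicalSpace M] [ChartedSpace R4 M] {S : Spacetime M} {e : Chart M}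
  {f : ℝ → ℝ → ℝ → ℝ}

namespace Spacetime

theorem IsPPMetricIn.eventually_eq (h : S.IsPPMetricIn e f) {x : R4} (hx : x ∈ e.range) :
    ∀ᶠ y in 𝓝 x, S.g e y = ppMatrix (profile f y) := by
  filter_upwards [e.isOpen_range.mem_nhds hx] with y hy using h y hy

theorem IsPPMetricIn.profile_smooth (h : S.IsPPMetricIn e f) {x : R4} (hx : x ∈ e.range) :
    ContDiffAt ℝ ∞ (profile f) x :=
  (S.g_smoothAt hx 3 3).congr_of_eventuallyEq ((h.eventually_eq hx).mono fun _ hy =>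
    (congrFun (congrFun hy 3) 3).symm)

theorem IsPPMetricIn.pd_profile (h : S.IsPPMetricIn e f) {x : R4} (hx : x ∈ e.range) :
    pd 0 (profile f) x = 0 :=
  pd_eq_zero_of_line (smooth_differentiableAt (h.profile_smooth hx))
    (Eventually.of_forall fun t => by simp [profile])

theorem IsPPMetricIn.isPPData (h : S.IsPPMetricIn e f) {a : R4 → ℝ}
    (ha : ∀ x ∈ e.range, ContDiffAt ℝ ∞ a x) (ha' : ∀ x ∈ e.range, ∀ μ, μ ≠ 3 → pd μ a x = 0)
    {x : R4} (hx : x ∈ e.range) : IsPPData (profile f) a x := by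
  have hU := e.isOpen_range.mem_nhds hx
  exact ⟨by filter_upwards [hU] with y hy using h.profile_smooth hy,
    by filter_upwards [hU] with y hy using ha y hy,
    by filter_upwards [hU] with y hy using h.pd_profile hy,
    by filter_upwards [hU] with y hy using ha' y hy⟩

/-- In coordinates in which the metric is a pp-metric, the Ricci curvature is parallel if and only
if the gradient of the transverse Laplacian vanishes. -/
theorem IsPPMetricIn.ricciParallelIn_iff (h : S.IsPPMetricIn e f) :
    S.LCRicciParallelIn e ↔ ∀ x ∈ e.range, ∀ ρ, pd ρ (transverseLaplacian f) x = 0 := by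
  have hd : ∀ x ∈ e.range, IsPPData (profile f) (fun _ => 0) x := fun x hx =>
    h.isPPData (fun _ _ => contDiffAt_const) (fun _ _ _ _ => pd_const _) hx
  have key : ∀ x ∈ e.range, ∀ ρ μ ν,
      covDeriv₂ (leviCivita (S.g e)) (ricci (leviCivita (S.g e))) x ρ μ ν
        = if μ = 3 ∧ ν = 3 then 1 / 2 * pd ρ (transverseLaplacian f) x else 0 :=
    fun x hx => covDeriv_ricci_leviCivita_pp (hd x hx) (h.eventually_eq hx)
  constructor
  · intro hp x hx ρ
    have h1 := hp x hx ρ 3 3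
    rw [key x hx] at h1
    simpa using h1
  · intro hp x hx ρ μ ν
    rw [key x hx, hp x hx]
    simp

theorem IsPPMetricIn.transverseLaplacian_smooth (h : S.IsPPMetricIn e f) {x : R4}
    (hx : x ∈ e.range) : ContDiffAt ℝ ∞ (transverseLaplacian f) x :=
  (pd_smooth (pd_smooth (h.profile_smooth hx))).add (pd_smooth (pd_smooth (h.profile_smooth hx)))

/-- In a pp-chart adapted to `l`, the connection of a generalised pp-wave is the model connection,
with an amplitude that depends on `x³` only because the phase does. -/
theorem exists_conn_eq_ppForm {o : Orientation M} {l : VecField M} {φ : M → ℝ} {k : ℝ → ℝ}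
    (hcompat : S.MetricCompatible) (hphase : S.IsPhase l φ) (htor : S.TorsionIsDual o l φ k)
    (h : S.IsPPMetricIn e f) (hl : ∀ x ∈ e.range, l.v e x = ![1, 0, 0, 0]) :
    ∃ a : R4 → ℝ, ∀ x ∈ e.range, IsPPData (profile f) a x ∧
      ∀ μ, conn (S.Γ e) μ x = ppForm (profile f) a μ x := by
  set a : R4 → ℝ := fun x => o.sgn e x * k (φ (e.point x)) with hadef
  have ht : ∀ x ∈ e.range, ∀ κ μ ν,
      torsionLow (S.g e) (S.Γ e) x κ μ ν = a x * eps 0 κ μ ν := by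
    intro x hx κ μ ν
    have hdet : Real.sqrt |(S.g e x).det| = 1 := by
      rw [(h.eventually_eq hx).self_of_nhds, ppMatrix_det]; simp
    rw [htor e x hx, hodgeVector, hdet, hl x hx]
    simp [Fin.sum_univ_four, hadef, mul_assoc]
  -- `k` is an arbitrary function: the amplitude is smooth because it is a torsion component
  have hsmooth : ∀ x ∈ e.range, ContDiffAt ℝ ∞ a x := by
    intro x hx
    have hΓ : ∀ lam μ ν, ContDiffAt ℝ ∞ (fun y => S.Γ e y lam μ ν) x :=
      fun lam μ ν => S.conn_smoothAt hx μ lam ν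
    have h1 : ContDiffAt ℝ ∞ (fun y => torsionLow (S.g e) (S.Γ e) y 1 2 3) x :=
      ContDiffAt.sum fun lam _ => (S.g_smoothAt hx 1 lam).mul ((hΓ lam 2 3).sub (hΓ lam 3 2))
    refine h1.congr_of_eventuallyEq ?_
    filter_upwards [e.isOpen_range.mem_nhds hx] with y hy
    rw [ht y hy, eps_zero]
    simp
  have hpd : ∀ x ∈ e.range, ∀ μ, μ ≠ 3 → pd μ a x = 0 := by
    intro x hx μ hμ
    refine pd_eq_zero_of_line (smooth_differentiableAt (hsmooth x hx)) ?_
    have hφ : ∀ᶠ t in 𝓝 (0 : ℝ), φ (e.point (x + t • Pi.single μ 1)) = φ (e.point x) := by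
      refine eventually_const_on_line (H := fun y => φ (e.point y)) e.isOpen_range hx
        (fun y hy => smooth_differentiableAt
          ((hphase e).1.contDiffAt (e.isOpen_range.mem_nhds hy))) fun y hy => ?_
      rw [(hphase e).2 y hy, hl y hy, (h.eventually_eq hy).self_of_nhds]
      fin_cases μ
      · simp [ppMatrix, Fin.sum_univ_four]
      · simp [ppMatrix, Fin.sum_univ_four]
      · simp [ppMatrix, Fin.sum_univ_four]
      · exact absurd rfl hμ
    -- the sign is continuous with values `1` and `-1`, hence locally constant
    have hsgn : ∀ᶠ y in 𝓝 x, o.sgn e y = o.sgn e x := by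
      have hc := (o.sgn_cont e).continuousAt (e.isOpen_range.mem_nhds hx)
      filter_upwards [e.isOpen_range.mem_nhds hx, Metric.tendsto_nhds.1 hc 1 one_pos] with y hy hd
      rw [Real.dist_eq, abs_lt] at hd
      rcases o.sgn_eq e x hx with h1 | h1 <;> rcases o.sgn_eq e y hy with h2 | h2 <;>
        linarith [hd.1, hd.2]
    have hline : Tendsto (fun t : ℝ => x + t • (Pi.single μ 1 : R4)) (𝓝 0) (𝓝 x) := by
      have : Continuous fun t : ℝ => x + t • (Pi.single μ 1 : R4) := by fun_prop
      simpa using this.tendsto 0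
    filter_upwards [hφ, hline.eventually hsgn] with t h1 h2
    simp only [hadef, h1, h2]
  exact ⟨a, fun x hx => ⟨h.isPPData hsmooth hpd hx, conn_eq_ppForm (h.eventually_eq hx)
    (h.pd_profile hx) (hcompat e x hx) (ht x hx)⟩⟩

end Spacetime

end PPCharts

end MAG

end

theorem theorem1 {M : Type*} [TopologicalSpace M] [ChartedSpace MAG.R4 M]
    [IsManifold 𝓘(ℝ, MAG.R4) ∞ M] [T2Space M] [SecondCountableTopology M] [ConnectedSpace M]
    (S : MAG.Spacetime M) (o : MAG.Orientation M) (hS : S.IsGeneralisedPPWave o) :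
    (∀ (e : MAG.Chart M) (f : ℝ → ℝ → ℝ → ℝ), S.IsPPMetricIn e f →
      (S.LCRicciParallelIn e ↔
        ∀ x ∈ e.range, ∃ C : ℝ, ∀ᶠ y in nhds x, MAG.transverseLaplacian f y = C)) ∧
    (S.LCRicciParallel → S.SolvesMetricEquation ∧ S.SolvesConnectionEquation) := by
  refine ⟨fun e f h => h.ricciParallelIn_iff.trans
    (MAG.locally_constant_iff_pd_eq_zero e.isOpen_range fun x hx =>
      h.transverseLaplacian_smooth hx), fun hpar => ?_⟩
  obtain ⟨hcompat, l, φ, k, hpp, hphase, htor⟩ := hS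
  -- both pointwise equations are checked in a pp-chart around the point in question
  have key : ∀ (e : MAG.Chart M), ∀ x ∈ e.range,
      (∀ μ ν α β, (MAG.fieldStrength (MAG.conn (S.Γ e)) μ ν x
        * MAG.fieldStrength (MAG.conn (S.Γ e)) α β x).trace = 0) ∧
      ∀ ν, MAG.gaugeDiv (MAG.conn (S.Γ e)) (MAG.fieldDensity (S.g e) (MAG.conn (S.Γ e))) ν x
        = 0 := by
    intro e x hx
    obtain ⟨e', hp, ⟨f, hf⟩, hl⟩ := hpp (e.point x)
    have hxo : x ∈ e.overlap e' := ⟨hx, hp⟩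
    have hx' := MAG.Chart.change_mem_range hxo
    obtain ⟨a, ha⟩ := MAG.Spacetime.exists_conn_eq_ppForm hcompat hphase htor hf hl
    have hd := (ha _ hx').1
    have hc : ∀ μ, MAG.conn (S.Γ e') μ =ᶠ[nhds (e.change e' x)]
        MAG.ppForm (MAG.profile f) a μ := by
      intro μ
      filter_upwards [e'.isOpen_range.mem_nhds hx'] with y hy using (ha y hy).2 μ
    refine ⟨S.trace_eq_zero_of_change hxo fun μ ν α β => ?_,
      S.gaugeDiv_eq_zero_of_change hxo fun ν => ?_⟩
    · rw [MAG.fieldStrength_congr hc, MAG.fieldStrength_congr hc, MAG.fieldStrength_ppForm hd,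
        MAG.fieldStrength_ppForm hd, MAG.nullRot_trace_mul]
    · rw [MAG.gaugeDiv_congr hc fun μ ν => MAG.fieldDensity_congr hc μ ν]
      exact MAG.gaugeDiv_ppForm hd (hf.eventually_eq hx')
        (hf.ricciParallelIn_iff.1 (hpar e') _ hx') ν
  exact ⟨fun e => MAG.metricStationary_of_trace_eq_zero fun x hx => (key e x hx).1,
    fun e => MAG.connectionStationary_of_yangMills (fun x hx => S.g_smoothAt hx)
      (S.g_symm e) (fun x hx => S.g_det_ne_zero hx) (fun x hx => S.conn_smoothAt hx)
      (fun x hx => (key e x hx).1) fun x hx => (key e x hx).2⟩
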